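/- Let $\mathfrak h$ be a complex separable Hilbert space, $\mathfrak H^{(n)}=\bigwedge^n\mathfrak h$ the $n$-particle space (the closed span of the vectors $f_1\wedge\cdots\wedge f_n$, with $\langle f_1\wedge\cdots\wedge f_n|g_1\wedge\cdots\wedge g_n\rangle=\det(\langle f_i|g_j\rangle)$), $\mathfrak F=\bigoplus_{n\ge 0}\mathfrak H^{(n)}$ the fermion Fock space, $\mathbb N=\bigoplus_n n\cdot\mathbf 1_{\mathfrak H^{(n)}}$ the number operator, $c^*(f)$ the creation operator $\Psi\mapsto f\wedge\Psi$ and $c(f)=c^*(f)^*$. A density matrix is a positive trace-class operator $\rho$ on $\mathfrak F$ with $\mathrm{Tr}\,\rho=1$ that is even, i.e. $\langle\phi|\rho\psi\rangle=0$ for $\phi\in\mathfrak H^{(m)}$, $\psi\in\mathfrak H^{(n)}$ with $m-n$ odd; it is an $N$-particle density matrix if $\rho\,\mathbb N=\mathbb N\rho=N\rho$. Its one-particle reduced density matrix (1-RDM) is the operator $\gamma_\rho^{(1)}$ on $\mathfrak h$ with $\langle g|\gamma_\rho^{(1)}f\rangle=\mathrm{Tr}_{\mathfrak F}[\rho\,c^*(f)c(g)]$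 for all $f,g\in\mathfrak h$. **Theorem.** Let $N\ge 2$ be an integer and let $\gamma$ be a trace-class operator on $\mathfrak h$ with $0\le\gamma\le\mathbf 1$ and $\mathrm{Tr}\,\gamma=N$. Then $\gamma$ is $N$-representable: there is an $N$-particle density matrix $\rho$ on $\mathfrak F$ with $\gamma_\rho^{(1)}=\gamma$. Moreover, $\rho$ can be taken to be a phase-averaged mixture of Slater determinants: there exist a countable index set $J$, an orthonormal family $(f_j)_{j\in J}$ in $\mathfrak h$ and numbers $\lambda_j>0$ with $\gamma=\sum_{j\in J}\lambda_j|f_j\rangle\langle f_j|$, and orthonormal vectors $G^{(1)},\dots,G^{(N)}\in\ell^2(J)$ with $\sum_{n=1}^N|G^{(n)}_j|^2=\lambda_j$ for all $j\in J$; and for every choice of such data the operator $$\rho_{\mathrm{av}}=\int_{[0,1]^J}\bigl|g_1^{(\theta)}\wedge\cdots\wedge g_N^{(\theta)}\bigr\rangle\bigl\langle g_1^{(\theta)}\wedge\cdots\wedge g_N^{(\theta)}\bigr|\,d\theta,\qquad g_n^{(\theta)}=\sum_{j\in J}e^{2\pi i\theta_j}G^{(n)}_j f_j,$$ where $d\theta$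 is the product of the Lebesgue measures on $[0,1]$, is an $N$-particle density matrix with $\gamma_{\rho_{\mathrm{av}}}^{(1)}=\gamma$. -/

import Mathlib

open MeasureTheory
open scoped InnerProductSpace ComplexConjugate

noncomputable section

namespace FermiFock

universe u

section Algebraic

variable {h : Type u} [NormedAddCommGroup h] [InnerProductSpace ℂ h]

/-- Annihilation `c(f)` on the exterior algebra: the antiderivation contracting with `⟪f, ·⟫`,
i.e. `c(f) 1 = 0` and `c(f) (g ∧ x) = ⟪f, g⟫ x - g ∧ c(f) x`. -/
def algAnnihilation (f : h) : Module.End ℂ (ExteriorAlgebra ℂ h) :=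
  CliffordAlgebra.contractLeft (Q := (0 : QuadraticForm ℂ h)) (innerₛₗ ℂ f)

/-- Creation `c*(f)` on the exterior algebra: `x ↦ f ∧ x`. -/
def algCreation (f : h) : Module.End ℂ (ExteriorAlgebra ℂ h) :=
  LinearMap.mulLeft ℂ (ExteriorAlgebra.ι ℂ f)

lemma algAnnihilation_one (f : h) : algAnnihilation f 1 = 0 :=
  CliffordAlgebra.contractLeft_one _ _

lemma algAnnihilation_ι_mul (f g : h) (x : ExteriorAlgebra ℂ h) :
    algAnnihilation f (ExteriorAlgebra.ι ℂ g * x) =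
      ⟪f, g⟫_ℂ • x - ExteriorAlgebra.ι ℂ g * algAnnihilation f x :=
  CliffordAlgebra.contractLeft_ι_mul (Q := (0 : QuadraticForm ℂ h)) _ _ _

lemma algAnnihilation_sq (f : h) (x : ExteriorAlgebra ℂ h) :
    algAnnihilation f (algAnnihilation f x) = 0 :=
  CliffordAlgebra.contractLeft_contractLeft (Q := (0 : QuadraticForm ℂ h)) _ _

variable (h) in
/-- The opposite of the endomorphism algebra of `⋀ h`, on which complex scalars act through their
conjugates. -/
def ConjOpEnd : Type u := (Module.End ℂ (ExteriorAlgebra ℂ h))ᵐᵒᵖ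

instance : Ring (ConjOpEnd h) :=
  inferInstanceAs (Ring (Module.End ℂ (ExteriorAlgebra ℂ h))ᵐᵒᵖ)

instance : Algebra ℂ (ConjOpEnd h) :=
  ((algebraMap ℂ (Module.End ℂ (ExteriorAlgebra ℂ h))ᵐᵒᵖ).comp (starRingEnd ℂ)).toAlgebra'
    fun c x => Algebra.commutes (A := (Module.End ℂ (ExteriorAlgebra ℂ h))ᵐᵒᵖ) (conj c) x

/-- The endomorphism underlying an element of `ConjOpEnd h`. -/
def ConjOpEnd.toEnd (a : ConjOpEnd h) : Module.End ℂ (ExteriorAlgebra ℂ h) :=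
  MulOpposite.unop a

lemma ConjOpEnd.toEnd_smul (c : ℂ) (a : ConjOpEnd h) : (c • a).toEnd = conj c • a.toEnd := by
  rw [Algebra.smul_def]
  change a.toEnd * algebraMap ℂ (Module.End ℂ (ExteriorAlgebra ℂ h)) (conj c) = _
  rw [← Algebra.commutes, ← Algebra.smul_def]

/-- The conjugate-linear map `f ↦ c(f)`, as a linear map into `ConjOpEnd h`. -/
def annihilationₗ : h →ₗ[ℂ] ConjOpEnd h where
  toFun f := MulOpposite.op (algAnnihilation f)
  map_add' f g := by
    apply MulOpposite.unop_injective
    change algAnnihilation (f + g) = algAnnihilation f + algAnnihilation g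
    simp [algAnnihilation]
  map_smul' c f := by
    apply MulOpposite.unop_injective
    refine Eq.trans ?_ (ConjOpEnd.toEnd_smul c _).symm
    change algAnnihilation (c • f) = conj c • algAnnihilation f
    simp [algAnnihilation]

/-- The conjugate-linear extension `f₁ ∧ ⋯ ∧ fₙ ↦ c(fₙ) ⋯ c(f₁)`. -/
def annihilationHom : ExteriorAlgebra ℂ h →ₐ[ℂ] ConjOpEnd h :=
  ExteriorAlgebra.lift ℂ ⟨annihilationₗ, fun f => by
    apply MulOpposite.unop_injective
    exact LinearMap.ext fun x => algAnnihilation_sq f x⟩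

/-- The sesquilinear form on `⋀ h`, determined by
`⟨f₁ ∧ ⋯ ∧ fₙ, y⟩ =` the scalar part of `c(fₙ) ⋯ c(f₁) y`. -/
def algInner (x y : ExteriorAlgebra ℂ h) : ℂ :=
  ExteriorAlgebra.algebraMapInv ((annihilationHom x).toEnd y)

lemma algInner_add_left (x y z : ExteriorAlgebra ℂ h) :
    algInner (x + y) z = algInner x z + algInner y z := by
  have h1 : annihilationHom (x + y) = annihilationHom x + annihilationHom y := map_add _ _ _
  simp only [algInner, h1]
  exact map_add ExteriorAlgebra.algebraMapInv _ _

lemma algInner_add_right (x y z : ExteriorAlgebra ℂ h) :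
    algInner x (y + z) = algInner x y + algInner x z := by
  simp [algInner]

lemma algInner_sub_right (x y z : ExteriorAlgebra ℂ h) :
    algInner x (y - z) = algInner x y - algInner x z := by
  simp [algInner]

lemma algInner_smul_left (c : ℂ) (x y : ExteriorAlgebra ℂ h) :
    algInner (c • x) y = conj c * algInner x y := by
  simp only [algInner, map_smul, ConjOpEnd.toEnd_smul]
  simp

lemma algInner_smul_right (c : ℂ) (x y : ExteriorAlgebra ℂ h) :
    algInner x (c • y) = c * algInner x y := by
  simp [algInner]

lemma algInner_one_left (y : ExteriorAlgebra ℂ h) :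
    algInner 1 y = ExteriorAlgebra.algebraMapInv y := by
  simp only [algInner, map_one]
  rfl

/-- Creation and annihilation are adjoint to each other. -/
lemma algInner_creation_left (f : h) (x y : ExteriorAlgebra ℂ h) :
    algInner (ExteriorAlgebra.ι ℂ f * x) y = algInner x (algAnnihilation f y) := by
  have h1 : annihilationHom (ExteriorAlgebra.ι ℂ f) = annihilationₗ f :=
    ExteriorAlgebra.lift_ι_apply ℂ _ _ _
  simp only [algInner, map_mul, h1]
  rfl

lemma algebraMapInv_ι_mul (f : h) (x : ExteriorAlgebra ℂ h) :
    ExteriorAlgebra.algebraMapInv (ExteriorAlgebra.ι ℂ f * x) = 0 := by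
  rw [map_mul]
  simp [ExteriorAlgebra.algebraMapInv]

lemma algInner_creation_right (f : h) (x y : ExteriorAlgebra ℂ h) :
    algInner x (ExteriorAlgebra.ι ℂ f * y) = algInner (algAnnihilation f x) y := by
  induction x using CliffordAlgebra.left_induction generalizing y with
  | algebraMap r =>
    rw [Algebra.algebraMap_eq_smul_one, algInner_smul_left, map_smul]
    erw [algAnnihilation_one, algInner_one_left, algebraMapInv_ι_mul]
    have := algInner_smul_left 0 0 y
    simp only [zero_smul, map_zero, zero_mul] at this
    simp [this]
  | add a b ha hb => rw [algInner_add_left, ha, hb, map_add, algInner_add_left]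
  | ι_mul a g ih =>
    change algInner (ExteriorAlgebra.ι ℂ g * a) _ =
      algInner (algAnnihilation f (ExteriorAlgebra.ι ℂ g * a)) y
    rw [algInner_creation_left, algAnnihilation_ι_mul, algAnnihilation_ι_mul,
      algInner_sub_right, sub_eq_add_neg, sub_eq_add_neg, algInner_add_left, ih,
      algInner_smul_right, algInner_smul_left, inner_conj_symm,
      ← neg_one_smul ℂ (ExteriorAlgebra.ι ℂ g * _), algInner_smul_left, algInner_creation_left]
    simp

lemma algInner_conj_symm (x y : ExteriorAlgebra ℂ h) : conj (algInner y x) = algInner x y := by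
  induction x using CliffordAlgebra.left_induction generalizing y with
  | algebraMap r =>
    induction y using CliffordAlgebra.left_induction with
    | algebraMap s =>
      simp only [Algebra.algebraMap_eq_smul_one, algInner_smul_left, algInner_smul_right]
      erw [algInner_one_left]
      simp [mul_comm]
    | add a b ha hb => rw [algInner_add_left, map_add, ha, hb, algInner_add_right]
    | ι_mul a g _ =>
      change conj (algInner (ExteriorAlgebra.ι ℂ g * a) _) =
        algInner _ (ExteriorAlgebra.ι ℂ g * a)
      rw [algInner_creation_left, algInner_creation_right]
      have h1 : algAnnihilation g
          ((algebraMap ℂ (ExteriorAlgebra ℂ h)) r) = 0 := by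
        rw [Algebra.algebraMap_eq_smul_one, map_smul, algAnnihilation_one, smul_zero]
      erw [h1]
      have h2 := algInner_smul_left 0 0 a
      have h3 := algInner_smul_right 0 a 0
      simp only [zero_smul, map_zero, zero_mul] at h2 h3
      simp [h2, h3]
  | add a b ha hb => rw [algInner_add_right, map_add, ha, hb, algInner_add_left]
  | ι_mul a g ih =>
    change conj (algInner _ (ExteriorAlgebra.ι ℂ g * a)) =
      algInner (ExteriorAlgebra.ι ℂ g * a) _
    rw [algInner_creation_left, algInner_creation_right, ih]

/-- The subalgebra of `⋀ h` generated by the vectors of a list, as a subspace (for an orthonormal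
list `e :: l`, each element is `a + e ∧ b` with `a, b` generated by `l`). -/
def listSpan : List h → Submodule ℂ (ExteriorAlgebra ℂ h)
  | [] => Submodule.span ℂ {1}
  | e :: l => listSpan l ⊔ (listSpan l).map (algCreation e)

lemma mem_listSpan_cons {e : h} {l : List h} {x : ExteriorAlgebra ℂ h} :
    x ∈ listSpan (e :: l) ↔
      ∃ a ∈ listSpan l, ∃ b ∈ listSpan l, x = a + ExteriorAlgebra.ι ℂ e * b := by
  simp only [listSpan, Submodule.mem_sup, Submodule.mem_map]
  constructor
  · rintro ⟨a, ha, _, ⟨b, hb, rfl⟩, rfl⟩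
    exact ⟨a, ha, b, hb, rfl⟩
  · rintro ⟨a, ha, b, hb, rfl⟩
    exact ⟨a, ha, _, ⟨b, hb, rfl⟩, rfl⟩

lemma one_mem_listSpan (l : List h) : (1 : ExteriorAlgebra ℂ h) ∈ listSpan l := by
  induction l with
  | nil => exact Submodule.mem_span_singleton_self _
  | cons e l ih => exact Submodule.mem_sup_left ih

lemma ι_swap (f g : h) (x : ExteriorAlgebra ℂ h) :
    ExteriorAlgebra.ι ℂ f * (ExteriorAlgebra.ι ℂ g * x) =
      -(ExteriorAlgebra.ι ℂ g * (ExteriorAlgebra.ι ℂ f * x)) := by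
  rw [← mul_assoc, ← mul_assoc, eq_neg_iff_add_eq_zero, ← add_mul,
    ExteriorAlgebra.ι_add_mul_swap, zero_mul]

lemma ι_mul_mem_listSpan {l : List h} {g : h} (hg : g ∈ l) {x : ExteriorAlgebra ℂ h}
    (hx : x ∈ listSpan l) : ExteriorAlgebra.ι ℂ g * x ∈ listSpan l := by
  induction l generalizing x with
  | nil => simp at hg
  | cons e l ih =>
    obtain ⟨a, ha, b, hb, rfl⟩ := mem_listSpan_cons.1 hx
    rcases List.mem_cons.1 hg with rfl | hg
    · refine mem_listSpan_cons.2 ⟨0, zero_mem _, a, ha, ?_⟩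
      rw [mul_add, ← mul_assoc, ExteriorAlgebra.ι_sq_zero]
      simp
    · refine mem_listSpan_cons.2 ⟨_, ih hg ha, _, neg_mem (ih hg hb), ?_⟩
      rw [mul_add, ι_swap, mul_neg]

lemma ι_span_mul_mem_listSpan {l : List h} {g : h} (hg : g ∈ Submodule.span ℂ {v | v ∈ l})
    {x : ExteriorAlgebra ℂ h} (hx : x ∈ listSpan l) :
    ExteriorAlgebra.ι ℂ g * x ∈ listSpan l := by
  induction hg using Submodule.span_induction with
  | mem v hv => exact ι_mul_mem_listSpan hv hx
  | zero => simp
  | add u v _ _ hu hv => rw [map_add, add_mul]; exact add_mem hu hv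
  | smul c v _ hv => rw [map_smul, smul_mul_assoc]; exact Submodule.smul_mem _ _ hv

lemma algAnnihilation_listSpan {l : List h} {e : h} (he : ∀ v ∈ l, ⟪e, v⟫_ℂ = 0)
    {x : ExteriorAlgebra ℂ h} (hx : x ∈ listSpan l) : algAnnihilation e x = 0 := by
  induction l generalizing x with
  | nil =>
    obtain ⟨c, rfl⟩ := Submodule.mem_span_singleton.1 hx
    rw [map_smul, algAnnihilation_one, smul_zero]
  | cons v l ih =>
    obtain ⟨a, ha, b, hb, rfl⟩ := mem_listSpan_cons.1 hx
    have h1 : ∀ v ∈ l, ⟪e, v⟫_ℂ = 0 := fun w hw => he w (List.mem_cons_of_mem _ hw)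
    rw [map_add, ih h1 ha, algAnnihilation_ι_mul, ih h1 hb, he v List.mem_cons_self]
    simp

lemma algInner_self_listSpan {l : List h} (hn : ∀ v ∈ l, ⟪v, v⟫_ℂ = 1)
    (ho : l.Pairwise fun v w => ⟪v, w⟫_ℂ = 0) {x : ExteriorAlgebra ℂ h} (hx : x ∈ listSpan l) :
    0 ≤ (algInner x x).re ∧ ((algInner x x).re = 0 → x = 0) := by
  induction l generalizing x with
  | nil =>
    obtain ⟨c, rfl⟩ := Submodule.mem_span_singleton.1 hx
    rw [algInner_smul_left, algInner_smul_right, algInner_one_left, map_one, mul_one,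
      mul_comm, Complex.mul_conj]
    refine ⟨by simpa using Complex.normSq_nonneg c, fun h0 => ?_⟩
    have : c = 0 := by simpa using h0
    simp [this]
  | cons e l ih =>
    obtain ⟨a, ha, b, hb, rfl⟩ := mem_listSpan_cons.1 hx
    rw [List.pairwise_cons] at ho
    have hn' : ∀ v ∈ l, ⟪v, v⟫_ℂ = 1 := fun w hw => hn w (List.mem_cons_of_mem _ hw)
    have ea := algAnnihilation_listSpan ho.1 ha
    have eb := algAnnihilation_listSpan ho.1 hb
    have z1 : ∀ y : ExteriorAlgebra ℂ h, algInner y 0 = 0 := fun y => by simp [algInner]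
    have z2 : ∀ y : ExteriorAlgebra ℂ h, algInner 0 y = 0 := fun y => by
      rw [← algInner_conj_symm, z1, map_zero]
    have key : algInner (a + ExteriorAlgebra.ι ℂ e * b) (a + ExteriorAlgebra.ι ℂ e * b) =
        algInner a a + algInner b b := by
      rw [algInner_add_left, algInner_add_right, algInner_add_right, algInner_creation_right, ea,
        algInner_creation_left, ea, algInner_creation_left, algAnnihilation_ι_mul, eb,
        hn e List.mem_cons_self, z1, z2]
      simp
    obtain ⟨a1, a2⟩ := ih hn' ho.2 ha
    obtain ⟨b1, b2⟩ := ih hn' ho.2 hb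
    rw [key, Complex.add_re]
    refine ⟨add_nonneg a1 b1, fun h0 => ?_⟩
    rw [a2 (by linarith), b2 (by linarith)]
    simp

lemma exists_mem_listSpan (x : ExteriorAlgebra ℂ h) :
    ∃ l : List h, (∀ v ∈ l, ⟪v, v⟫_ℂ = 1) ∧ (l.Pairwise fun v w => ⟪v, w⟫_ℂ = 0) ∧
      x ∈ listSpan l := by
  have main : ∃ W : Submodule ℂ h, FiniteDimensional ℂ W ∧ ∀ S : Submodule ℂ (ExteriorAlgebra ℂ h),
      1 ∈ S → (∀ g ∈ W, ∀ y ∈ S, ExteriorAlgebra.ι ℂ g * y ∈ S) → x ∈ S := by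
    induction x using CliffordAlgebra.left_induction with
    | algebraMap r =>
      refine ⟨⊥, inferInstance, fun S h1 _ => ?_⟩
      rw [Algebra.algebraMap_eq_smul_one]
      exact S.smul_mem r h1
    | add a b ha hb =>
      obtain ⟨W, _, hW⟩ := ha
      obtain ⟨W', _, hW'⟩ := hb
      refine ⟨W ⊔ W', inferInstance, fun S h1 h2 => add_mem (hW S h1 fun g hg => ?_)
        (hW' S h1 fun g hg => ?_)⟩
      · exact h2 g (Submodule.mem_sup_left hg)
      · exact h2 g (Submodule.mem_sup_right hg)
    | ι_mul a g ha =>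
      obtain ⟨W, _, hW⟩ := ha
      refine ⟨W ⊔ Submodule.span ℂ {g}, inferInstance, fun S h1 h2 => ?_⟩
      exact h2 g (Submodule.mem_sup_right (Submodule.mem_span_singleton_self g)) a
        (hW S h1 fun g hg => h2 g (Submodule.mem_sup_left hg))
  obtain ⟨W, _, hW⟩ := main
  let b := stdOrthonormalBasis ℂ W
  have hb : ∀ i j, ⟪(b i : h), (b j : h)⟫_ℂ = if i = j then 1 else 0 :=
    fun i j => orthonormal_iff_ite.1 b.orthonormal i j
  refine ⟨List.ofFn fun i => (b i : h), ?_, ?_, ?_⟩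
  · intro v hv
    obtain ⟨i, rfl⟩ := (List.mem_ofFn' _ _).1 hv
    rw [hb, if_pos rfl]
  · rw [List.pairwise_ofFn]
    intro i j hij
    rw [hb, if_neg hij.ne]
  · refine hW _ (one_mem_listSpan _) fun g hg y hy => ι_span_mul_mem_listSpan ?_ hy
    have h1 : (⟨g, hg⟩ : W) ∈ Submodule.span ℂ (Set.range b) := by
      have := b.toBasis.span_eq
      rw [OrthonormalBasis.coe_toBasis] at this
      rw [this]
      trivial
    have h2 := Submodule.mem_map_of_mem (f := W.subtype) h1
    rw [Submodule.map_span] at h2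
    refine Submodule.span_mono ?_ h2
    rintro _ ⟨_, ⟨i, rfl⟩, rfl⟩
    exact (List.mem_ofFn' _ _).2 ⟨i, rfl⟩

end Algebraic

section Fock

variable (h : Type u) [NormedAddCommGroup h] [InnerProductSpace ℂ h]

/-- The inner product of `⋀ h = ⨁ₙ ⋀ⁿ h`: the summands are orthogonal and
`⟨f₁ ∧ ⋯ ∧ fₙ, g₁ ∧ ⋯ ∧ gₙ⟩ = det ⟨fᵢ, gⱼ⟩`. -/
instance innerCore : InnerProductSpace.Core ℂ (ExteriorAlgebra ℂ h) where
  inner := algInner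
  conj_inner_symm := algInner_conj_symm
  re_inner_nonneg x := by
    obtain ⟨l, h1, h2, h3⟩ := exists_mem_listSpan x
    exact (algInner_self_listSpan h1 h2 h3).1
  add_left := algInner_add_left
  smul_left x y r := algInner_smul_left r x y
  definite x h0 := by
    obtain ⟨l, h1, h2, h3⟩ := exists_mem_listSpan x
    exact (algInner_self_listSpan h1 h2 h3).2 (by rw [h0]; rfl)

instance : NormedAddCommGroup (ExteriorAlgebra ℂ h) :=
  InnerProductSpace.Core.toNormedAddCommGroup (𝕜 := ℂ)

instance : InnerProductSpace ℂ (ExteriorAlgebra ℂ h) := InnerProductSpace.ofCore _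

/-- The fermion Fock space over `h`: the Hilbert space completion of `⨁ₙ ⋀ⁿ h`. -/
abbrev Fock : Type u := UniformSpace.Completion (ExteriorAlgebra ℂ h)

variable {h}

/-- `f₁ ∧ ⋯ ∧ fₙ` as a vector of Fock space (for `n = 0` this is the vacuum). -/
def wedge {n : ℕ} (f : Fin n → h) : Fock h := ((ExteriorAlgebra.ιMulti ℂ n f :) : Fock h)

variable (h) in
/-- The `n`-particle space: the closed span of all `f₁ ∧ ⋯ ∧ fₙ`. -/
def sector (n : ℕ) : Submodule ℂ (Fock h) :=
  (Submodule.span ℂ (Set.range fun f : Fin n → h => wedge f)).topologicalClosure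

instance (n : ℕ) : CompleteSpace (sector h n) :=
  (Submodule.isClosed_topologicalClosure _).completeSpace_coe

lemma inner_alg (x y : ExteriorAlgebra ℂ h) : ⟪x, y⟫_ℂ = algInner x y := rfl

lemma norm_algCreation_le (f : h) (x : ExteriorAlgebra ℂ h) :
    ‖algCreation f x‖ ≤ ‖f‖ * ‖x‖ := by
  have h1 : ⟪algCreation f x, algCreation f x⟫_ℂ + ⟪algAnnihilation f x, algAnnihilation f x⟫_ℂ
      = ⟪f, f⟫_ℂ * ⟪x, x⟫_ℂ := by
    simp only [inner_alg]
    change algInner (ExteriorAlgebra.ι ℂ f * x) (ExteriorAlgebra.ι ℂ f * x) + _ = _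
    rw [algInner_creation_left, algAnnihilation_ι_mul, algInner_sub_right, algInner_smul_right,
      algInner_creation_right]
    ring
  simp only [inner_self_eq_norm_sq_to_K] at h1
  have h2 : ‖algCreation f x‖ ^ 2 + ‖algAnnihilation f x‖ ^ 2 = ‖f‖ ^ 2 * ‖x‖ ^ 2 := by
    exact_mod_cast h1
  refine (pow_le_pow_iff_left₀ (norm_nonneg _) (by positivity) two_ne_zero).1 ?_
  nlinarith [sq_nonneg ‖algAnnihilation f x‖]

/-- The creation operator `c*(f)`: the continuous extension of `x ↦ f ∧ x` to Fock space. -/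
def creation (f : h) : Fock h →L[ℂ] Fock h :=
  ((algCreation f).mkContinuous ‖f‖ (norm_algCreation_le f)).completion

/-- The annihilation operator `c(f) = (c*(f))†`. -/
def annihilation (f : h) : Fock h →L[ℂ] Fock h := (creation f).adjoint

lemma wedge_mem_sector {n : ℕ} (f : Fin n → h) : wedge f ∈ sector h n :=
  Submodule.le_topologicalClosure _ (Submodule.subset_span ⟨f, rfl⟩)

/-- The particle-number sectors are total in Fock space. -/
lemma eq_zero_of_forall_starProjection_eq_zero {φ : Fock h}
    (hφ : ∀ n : ℕ, (sector h n).starProjection φ = 0) : φ = 0 := by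
  have h1 : ∀ x : ExteriorAlgebra ℂ h, ⟪(x : Fock h), φ⟫_ℂ = 0 := by
    intro x
    have hx : x ∈ Submodule.span ℂ
        (Set.range fun p : Σ n, (Fin n → h) => ExteriorAlgebra.ιMulti ℂ p.1 p.2) := by
      rw [ExteriorAlgebra.ιMulti_span]
      trivial
    induction hx using Submodule.span_induction with
    | mem y hy =>
      obtain ⟨⟨n, f⟩, rfl⟩ := hy
      have h2 := (Submodule.starProjection_apply_eq_zero_iff (K := sector h n)).1 (hφ n)
      exact h2 _ (wedge_mem_sector f)
    | zero => rw [UniformSpace.Completion.coe_zero, inner_zero_left]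
    | add a b _ _ ha hb => rw [UniformSpace.Completion.coe_add, inner_add_left, ha, hb, add_zero]
    | smul c a _ ha => rw [UniformSpace.Completion.coe_smul, inner_smul_left, ha, mul_zero]
  have h2 : ∀ ψ : Fock h, ⟪ψ, φ⟫_ℂ = 0 := fun ψ =>
    UniformSpace.Completion.induction_on ψ (isClosed_eq (by fun_prop) (by fun_prop)) h1
  exact inner_self_eq_zero.1 (h2 φ)

variable (h) in
/-- The graph of the number operator `⨁ₙ n·1`: the pairs `(ψ, φ)` such that the `n`-particle
component of `φ` is `n` times that of `ψ`, for every `n`. -/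
def numberGraph : Submodule ℂ (Fock h × Fock h) where
  carrier := {p | ∀ n : ℕ,
    (sector h n).starProjection p.2 = (n : ℂ) • (sector h n).starProjection p.1}
  add_mem' {p q} hp hq n := by simp [hp n, hq n]
  zero_mem' n := by simp
  smul_mem' c p hp n := by simp [hp n, smul_comm c]

variable (h) in
/-- The particle number operator, with its maximal domain. -/
def numberOperator : Fock h →ₗ.[ℂ] Fock h := (numberGraph h).toLinearPMap

lemma numberOperator_graph : (numberOperator h).graph = numberGraph h :=
  Submodule.toLinearPMap_graph_eq _ fun p hp h0 =>
    eq_zero_of_forall_starProjection_eq_zero fun n => by simpa [h0] using hp n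

end Fock

section Trace

variable {H : Type u} [NormedAddCommGroup H] [InnerProductSpace ℂ H] [CompleteSpace H]

/-- `Tr A = t`: for every orthonormal basis `b`, the series `∑ᵢ ⟪bᵢ, A bᵢ⟫` converges
unconditionally to `t`. -/
def HasTrace (A : H →L[ℂ] H) (t : ℂ) : Prop :=
  ∀ (ι : Type u) (b : HilbertBasis ι ℂ H), HasSum (fun i => ⟪b i, A (b i)⟫_ℂ) t

/-- `A` is trace class: `|A| = (A† A)^(1/2)` has a finite trace. -/
def IsTraceClass (A : H →L[ℂ] H) : Prop := ∃ t : ℂ, HasTrace (CFC.abs A) t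

end Trace

section DensityMatrices

variable {h : Type u} [NormedAddCommGroup h] [InnerProductSpace ℂ h]

/-- Density matrices: even positive trace-class operators of unit trace on Fock space. -/
structure IsDensityMatrix (ρ : Fock h →L[ℂ] Fock h) : Prop where
  traceClass : IsTraceClass ρ
  nonneg : 0 ≤ ρ
  trace_eq_one : HasTrace ρ 1
  even : ∀ m n : ℕ, Odd ((m : ℤ) - n) → ∀ φ ∈ sector h m, ∀ ψ ∈ sector h n, ⟪φ, ρ ψ⟫_ℂ = 0

/-- `N`-particle density matrices: density matrices with `ρ 𝐍 = 𝐍 ρ = N ρ`, where `𝐍` is the number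
operator. -/
structure IsNParticleDensityMatrix (N : ℕ) (ρ : Fock h →L[ℂ] Fock h) : Prop
    extends IsDensityMatrix ρ where
  number_mul : ∀ ψ : Fock h, ∃ hψ : ρ ψ ∈ (numberOperator h).domain,
    numberOperator h ⟨ρ ψ, hψ⟩ = (N : ℂ) • ρ ψ
  mul_number : ∀ ψ : (numberOperator h).domain, ρ (numberOperator h ψ) = (N : ℂ) • ρ (ψ : Fock h)

/-- `γ` is the reduced one-particle density matrix (1-RDM) of `ρ`:
`⟪g, γ f⟫ = Tr[ρ c*(f) c(g)]` for all `f, g`. -/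
def IsOneRDM (ρ : Fock h →L[ℂ] Fock h) (γ : h →L[ℂ] h) : Prop :=
  ∀ f g : h, HasTrace (ρ ∘L creation f ∘L annihilation g) ⟪g, γ f⟫_ℂ

/-- `γ` is `N`-representable: it is the 1-RDM of an `N`-particle density matrix. -/
def IsNRepresentable (N : ℕ) (γ : h →L[ℂ] h) : Prop :=
  ∃ ρ : Fock h →L[ℂ] Fock h, IsNParticleDensityMatrix N ρ ∧ IsOneRDM ρ γ

/-- One-particle density matrices: trace-class operators on `h` with `0 ≤ γ ≤ 1`. -/
structure IsOneParticleDensityMatrix [CompleteSpace h] (γ : h →L[ℂ] h) : Prop where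
  traceClass : IsTraceClass γ
  nonneg : 0 ≤ γ
  le_one : γ ≤ 1

/-- The orbitals `gₙ(θ) = ∑ⱼ exp(2πi θⱼ) Gₙ(j) fⱼ` with phases `θⱼ ∈ [0, 1]`. -/
def phaseOrbital {J : Set ℕ} {N : ℕ} (f : J → h) (G : Fin N → lp (fun _ : J => ℂ) 2)
    (θ : J → unitInterval) (n : Fin N) : h :=
  ∑' j : J, (Complex.exp (2 * Real.pi * Complex.I * (θ j : ℝ)) * G n j) • f j

/-- The average of the projections onto the Slater determinants `g₁(θ) ∧ ⋯ ∧ g_N(θ)` over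
independent phases `θⱼ` that are uniformly distributed in `[0, 1]`. -/
def phaseAverage {J : Set ℕ} {N : ℕ} (f : J → h) (G : Fin N → lp (fun _ : J => ℂ) 2) :
    Fock h →L[ℂ] Fock h :=
  ∫ θ : J → unitInterval,
    InnerProductSpace.rankOne ℂ (wedge (phaseOrbital f G θ)) (wedge (phaseOrbital f G θ))
      ∂(Measure.infinitePi fun _ : J => (volume : Measure unitInterval))

/-- `ρ` is a phase-averaged mixture of Slater determinants built from `γ`: there are an orthonormal
family `(fⱼ)` of eigenvectors of `γ` with eigenvalues `lamⱼ > 0`, such that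
`γ = ∑ⱼ lamⱼ |fⱼ⟩⟨fⱼ|`, and `N` orthonormal vectors `Gₙ ∈ ℓ²(J)` with `∑ₙ |Gₙ(j)|² = lamⱼ`, such that
`ρ` is the corresponding phase average. -/
def IsPhaseAveragedMixture (N : ℕ) (γ : h →L[ℂ] h) (ρ : Fock h →L[ℂ] Fock h) : Prop :=
  ∃ (J : Set ℕ) (f : J → h) (lam : J → ℝ) (G : Fin N → lp (fun _ : J => ℂ) 2),
    Orthonormal ℂ f ∧ (∀ j, 0 < lam j) ∧
    (∀ x : h, HasSum (fun j => ((lam j : ℂ) * ⟪f j, x⟫_ℂ) • f j) (γ x)) ∧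
    Orthonormal ℂ G ∧ (∀ j, ∑ n, ‖G n j‖ ^ 2 = lam j) ∧
    ρ = phaseAverage f G

end DensityMatrices

end FermiFock

end

/-!
A Slater determinant of orthonormal orbitals `g₁, …, g_N` is a unit vector of the `N`-particle
sector whose one-particle reduced density matrix is the projection onto the span of the `gₙ`
(`norm_wedge`, `inner_annihilation_wedge`). An average of the corresponding rank-one projections
over any compact probability space of such vectors is therefore an `N`-particle density matrix
(`isNParticleDensityMatrix_integral`), and its reduced density matrix is the average of the
projections onto the orbitals.

For the orbitals `gₙ(θ) = ∑ⱼ exp (2πi θⱼ) Gₙ(j) fⱼ` the phases of different modes are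
uncorrelated, so that the average of `∑ₙ |gₙ(θ)⟩⟨gₙ(θ)|` is diagonal in `(fⱼ)` with weights `∑ₙ
|Gₙ(j)|² = lamⱼ` (`hasSum_integral_phaseOrbital`); this is the spectral decomposition of `γ`.

Such data exist. A positive operator of finite trace is compact, hence diagonal in an orthonormal
family (`exists_spectral_decomposition`). Its eigenvalues lie in `(0, 1]` and add up to the
integer `N`, so by the carpenter's theorem (`exists_orthonormal_lp`) they are the diagonal of a
projection of rank `N` on `ℓ²(J)`, and the `Gₙ` are an orthonormal basis of its range. For
finitely many weights that projection is built from a coordinate projection by rotations in two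
coordinates. An infinite sequence is reduced to the finite case by merging its tail, of total
weight at most `1`, into one coordinate, which is split up again proportionally.

Traces are taken over Hilbert bases with arbitrary index sets. The interchange of trace and
average rests on Dini's theorem, which gives uniform convergence of Hilbert basis expansions on
compact families of vectors (`eventually_norm_sub_sum_lt`).
-/

namespace FermiFock

/-! ### Projections with prescribed diagonal -/

/-- Rotating the columns `a` and `b` of a matrix with orthonormal rows preserves the sum of their
squared norms, and the squared norm of column `a` takes every value between the two original ones. -/
lemma exists_rotate_columns {ι : Type*} [Fintype ι] {N : ℕ} {G : Fin N → ι → ℝ}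
    (hG : ∀ m n, ∑ j, G m j * G n j = if m = n then 1 else 0) {a b : ι} (hab : a ≠ b)
    {x y : ℝ} (hx1 : ∑ n, G n b ^ 2 ≤ x) (hx2 : x ≤ ∑ n, G n a ^ 2)
    (hxy : x + y = ∑ n, G n a ^ 2 + ∑ n, G n b ^ 2) :
    ∃ G' : Fin N → ι → ℝ, (∀ m n, ∑ j, G' m j * G' n j = if m = n then 1 else 0) ∧
      ∑ n, G' n a ^ 2 = x ∧ ∑ n, G' n b ^ 2 = y ∧ ∀ j, j ≠ a → j ≠ b → ∀ n, G' n j = G n j := by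
  classical
  let w : ℝ → ℝ := fun t => ∑ n, (Real.cos t * G n a + Real.sin t * G n b) ^ 2
  have hw : Continuous w := by fun_prop
  have hmem : x ∈ Set.Icc (w (Real.pi / 2)) (w 0) := by simp [w, hx1, hx2]
  obtain ⟨t, -, ht⟩ := intermediate_value_Icc' (by positivity) hw.continuousOn hmem
  have hcs := Real.sin_sq_add_cos_sq t
  let G' : Fin N → ι → ℝ := fun n j =>
    if j = a then Real.cos t * G n a + Real.sin t * G n b
    else if j = b then -Real.sin t * G n a + Real.cos t * G n b else G n j
  have ga : ∀ n, G' n a = Real.cos t * G n a + Real.sin t * G n b := fun n => if_pos rfl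
  have gb : ∀ n, G' n b = -Real.sin t * G n a + Real.cos t * G n b := fun n => by
    simp [G', hab.symm]
  have go : ∀ j, j ≠ a → j ≠ b → ∀ n, G' n j = G n j := fun j h1 h2 n => by simp [G', h1, h2]
  have hxa : ∑ n, G' n a ^ 2 = x := by simpa only [ga] using ht
  refine ⟨G', fun m n => ?_, hxa, ?_, go⟩
  · rw [← hG m n, ← sub_eq_zero, ← Finset.sum_sub_distrib, Fintype.sum_eq_add a b hab,
      ga, ga, gb, gb]
    · linear_combination (G m a * G n a + G m b * G n b) * hcs
    · rintro j ⟨h1, h2⟩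
      rw [go j h1 h2, go j h1 h2, sub_self]
  · have : ∑ n, G' n a ^ 2 + ∑ n, G' n b ^ 2 = ∑ n, G n a ^ 2 + ∑ n, G n b ^ 2 := by
      rw [← Finset.sum_add_distrib, ← Finset.sum_add_distrib]
      refine Finset.sum_congr rfl fun n _ => ?_
      rw [ga, gb]
      linear_combination (G n a ^ 2 + G n b ^ 2) * hcs
    linarith

/-- The carpenter's theorem for finite index sets: weights in `[0, 1]` with sum `N` are the diagonal
of a real projection of rank `N`, here given by the `N` orthonormal rows spanning its range. -/
theorem exists_orthonormal_rows {ι : Type*} [Fintype ι] {N : ℕ} (lam : ι → ℝ)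
    (h0 : ∀ i, 0 ≤ lam i) (h1 : ∀ i, lam i ≤ 1) (hs : ∑ i, lam i = N) :
    ∃ G : Fin N → ι → ℝ, (∀ m n, ∑ j, G m j * G n j = if m = n then 1 else 0) ∧
      ∀ j, ∑ n, G n j ^ 2 = lam j := by
  classical
  induction hk : (Finset.univ.filter fun i => lam i ≠ 0 ∧ lam i ≠ 1).card
    using Nat.strong_induction_on generalizing lam with
  | _ k ih =>
  by_cases hfr : ∃ a, lam a ≠ 0 ∧ lam a ≠ 1
  · obtain ⟨a, ha0, ha1⟩ := hfr
    have ha0' : 0 < lam a := lt_of_le_of_ne (h0 a) ha0.symm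
    have ha1' : lam a < 1 := lt_of_le_of_ne (h1 a) ha1
    -- The total is an integer, so a fractional weight cannot be the only one.
    obtain ⟨b, hba, hb0, hb1⟩ : ∃ b, b ≠ a ∧ lam b ≠ 0 ∧ lam b ≠ 1 := by
      by_contra! hno
      have h2 : ∑ i ∈ Finset.univ.erase a, lam i =
          (((Finset.univ.erase a).filter fun i => lam i = 1).card : ℝ) := by
        rw [Finset.card_filter]
        push_cast
        refine Finset.sum_congr rfl fun i hi => ?_
        by_cases hi0 : lam i = 0
        · simp [hi0]
        · simp [hno i (Finset.ne_of_mem_erase hi) hi0]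
      rw [← Finset.add_sum_erase _ _ (Finset.mem_univ a), h2] at hs
      generalize ((Finset.univ.erase a).filter fun i => lam i = 1).card = M at hs
      have h3 : M < N := by exact_mod_cast (by linarith : (M : ℝ) < N)
      have h4 : N < M + 1 := by exact_mod_cast (by linarith : (N : ℝ) < M + 1)
      omega
    have hb0' : 0 < lam b := lt_of_le_of_ne (h0 b) hb0.symm
    have hb1' : lam b < 1 := lt_of_le_of_ne (h1 b) hb1
    -- Replace the two weights by extreme ones with the same sum.
    obtain ⟨p, q, hpq, hqa, hap, hq0, hp1, hext⟩ : ∃ p q : ℝ, p + q = lam a + lam b ∧ q ≤ lam a ∧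
        lam a ≤ p ∧ 0 ≤ q ∧ p ≤ 1 ∧ (q = 0 ∨ p = 1) := by
      rcases le_total (lam a + lam b) 1 with hle | hle
      · exact ⟨lam a + lam b, 0, by ring, h0 a, by linarith, le_rfl, hle, Or.inl rfl⟩
      · exact ⟨1, lam a + lam b - 1, by ring, by linarith, by linarith, by linarith, le_rfl,
          Or.inr rfl⟩
    let lam' : ι → ℝ := fun i => if i = a then p else if i = b then q else lam i
    have la : lam' a = p := if_pos rfl
    have lb : lam' b = q := by simp [lam', hba]
    have lo : ∀ j, j ≠ a → j ≠ b → lam' j = lam j := fun j h2 h3 => by simp [lam', h2, h3]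
    have hcard : (Finset.univ.filter fun i => lam' i ≠ 0 ∧ lam' i ≠ 1).card < k := by
      rw [← hk]
      refine Finset.card_lt_card (Finset.ssubset_iff_subset_ne.2 ⟨fun i => ?_, fun heq => ?_⟩)
      · simp only [Finset.mem_filter, Finset.mem_univ, true_and]
        by_cases hia : i = a
        · rw [hia]; exact fun _ => ⟨ha0, ha1⟩
        by_cases hib : i = b
        · rw [hib]; exact fun _ => ⟨hb0, hb1⟩
        rw [lo i hia hib]
        exact id
      · have e1 : lam' a ≠ 0 ∧ lam' a ≠ 1 := by
          have : a ∈ Finset.univ.filter fun i => lam i ≠ 0 ∧ lam i ≠ 1 := by simp [ha0, ha1]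
          rw [← heq] at this
          simpa using this
        have e2 : lam' b ≠ 0 ∧ lam' b ≠ 1 := by
          have : b ∈ Finset.univ.filter fun i => lam i ≠ 0 ∧ lam i ≠ 1 := by simp [hb0, hb1]
          rw [← heq] at this
          simpa using this
        rw [la] at e1
        rw [lb] at e2
        exact hext.elim e2.1 e1.2
    obtain ⟨G, hG1, hG2⟩ := ih _ hcard lam'
      (fun i => by simp only [lam']; split_ifs <;> first | exact h0 i | linarith)
      (fun i => by simp only [lam']; split_ifs <;> first | exact h1 i | linarith)
      (by
        rw [← hs, ← sub_eq_zero, ← Finset.sum_sub_distrib, Fintype.sum_eq_add a b hba.symm, la, lb]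
        · linarith
        · rintro j ⟨h2, h3⟩
          rw [lo j h2 h3, sub_self]) rfl
    obtain ⟨G', hG1', hGa, hGb, hGo⟩ := exists_rotate_columns hG1 hba.symm (x := lam a) (y := lam b)
      (by rwa [hG2, lb]) (by rwa [hG2, la]) (by rw [hG2, hG2, la, lb, hpq])
    refine ⟨G', hG1', fun j => ?_⟩
    by_cases hja : j = a
    · rw [hja, hGa]
    by_cases hjb : j = b
    · rw [hjb, hGb]
    simp only [hGo j hja hjb, hG2, lo j hja hjb]
  · -- All weights are `0` or `1`: take the coordinate projection onto the weights `1`.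
    have h01 : ∀ i, lam i = if lam i = 1 then 1 else 0 := fun i => by
      by_cases hi : lam i = 1
      · simp [hi]
      · rw [if_neg hi]
        by_contra hi0
        exact hfr ⟨i, hi0, hi⟩
    have hcard : (Finset.univ.filter fun i => lam i = 1).card = N := by
      rw [Finset.sum_congr rfl fun i _ => h01 i, Finset.sum_boole] at hs
      exact_mod_cast hs
    let e := (Finset.equivFinOfCardEq hcard).symm
    refine ⟨fun n j => if (e n : ι) = j then 1 else 0, fun m n => ?_, fun j => ?_⟩
    · simp only [ite_mul, one_mul, zero_mul, Finset.sum_ite_eq, Finset.mem_univ, if_true]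
      simp only [Subtype.coe_inj, e.injective.eq_iff, eq_comm]
    · rw [h01 j]
      simp only [ite_pow, one_pow, ne_eq, OfNat.ofNat_ne_zero, not_false_eq_true, zero_pow]
      by_cases hj : lam j = 1
      · rw [if_pos hj, Fintype.sum_eq_single (e.symm ⟨j, by simp [hj]⟩)]
        · simp
        · intro n hn
          rw [if_neg]
          rintro rfl
          simp at hn
      · rw [if_neg hj]
        refine Finset.sum_eq_zero fun n _ => if_neg ?_
        rintro rfl
        exact hj (Finset.mem_filter.1 (e n).2).2

/-- The carpenter's theorem in `ℓ²`: weights in `[0, 1]` with sum `N` are the diagonal of the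
projection onto the span of `N` orthonormal vectors of `ℓ²(J)`. -/
theorem exists_orthonormal_lp {J : Type*} {N : ℕ} (lam : J → ℝ) (h0 : ∀ j, 0 ≤ lam j)
    (h1 : ∀ j, lam j ≤ 1) (hs : HasSum lam N) :
    ∃ G : Fin N → lp (fun _ : J => ℂ) 2, Orthonormal ℂ G ∧ ∀ j, ∑ n, ‖G n j‖ ^ 2 = lam j := by
  classical
  -- A finite set carrying all but a remainder `r ≤ 1` of the total weight.
  obtain ⟨F, hF⟩ : ∃ F : Finset J, (N : ℝ) - 1 < ∑ j ∈ F, lam j :=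
    (hs.eventually_const_lt (by linarith)).exists
  set r : ℝ := N - ∑ j ∈ F, lam j with hr
  have hr0 : 0 ≤ r := sub_nonneg.2 (sum_le_hasSum F (fun j _ => h0 j) hs)
  obtain ⟨G, hG1, hG2⟩ := exists_orthonormal_rows (ι := Option F) (N := N)
    (fun o => o.elim r fun j => lam j) (by rintro (_ | j) <;> simp [h0, hr0])
    (by
      rintro (_ | j)
      · simp only [Option.elim]; linarith
      · simpa using h1 _)
    (by
      rw [Fintype.sum_option]
      simp only [Option.elim]
      rw [Finset.sum_coe_sort F lam, hr]
      ring)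
  have hr2 : ∑ n, G n none ^ 2 = r := hG2 none
  -- The remaining coordinate is spread over the complement of `F` with weights `lam j / r`.
  let H : Fin N → J → ℝ := fun n j =>
    if hj : j ∈ F then G n (some ⟨j, hj⟩) else Real.sqrt (lam j / r) * G n none
  have hout : HasSum (fun j => if j ∈ F then 0 else lam j) r := by
    have h2 : HasSum (fun j => if j ∈ F then lam j else 0) (∑ j ∈ F, lam j) := by
      rw [Finset.sum_congr rfl fun j (hj : j ∈ F) =>
        (if_pos hj : (if j ∈ F then lam j else 0) = _).symm]
      exact hasSum_sum_of_ne_finset_zero fun j hj => if_neg hj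
    have h3 : (fun j => if j ∈ F then 0 else lam j) =
        fun j => lam j - if j ∈ F then lam j else 0 := by
      funext j
      split_ifs <;> simp
    rw [h3]
    exact hs.sub h2
  have hH : ∀ m n, HasSum (fun j => H m j * H n j) (if m = n then 1 else 0) := by
    intro m n
    have h2 : HasSum (fun j => if hj : j ∈ F then G m (some ⟨j, hj⟩) * G n (some ⟨j, hj⟩) else 0)
        (∑ j : F, G m (some j) * G n (some j)) := by
      have h4 : ∑ j : F, G m (some j) * G n (some j) = ∑ j ∈ F,
          if hj : j ∈ F then G m (some ⟨j, hj⟩) * G n (some ⟨j, hj⟩) else 0 := by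
        rw [← Finset.sum_coe_sort F]
        exact Finset.sum_congr rfl fun j _ => by rw [dif_pos j.2]
      rw [h4]
      exact hasSum_sum_of_ne_finset_zero fun j hj => dif_neg hj
    have h3 := h2.add (hout.mul_right (r⁻¹ * (G m none * G n none)))
    convert h3 using 1
    · funext j
      by_cases hj : j ∈ F
      · simp [H, hj]
      · simp only [H, hj, dif_neg, not_false_eq_true, if_false, zero_add]
        linear_combination (G m none * G n none) * Real.mul_self_sqrt (div_nonneg (h0 j) hr0)
    · rw [← hG1 m n, Fintype.sum_option, add_comm]
      congr 1
      by_cases hrz : r = 0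
      · have h5 : G m none ^ 2 = 0 :=
          (Finset.sum_eq_zero_iff_of_nonneg fun n _ => sq_nonneg _).1 (hr2.trans hrz) m
            (Finset.mem_univ m)
        rw [pow_eq_zero_iff two_ne_zero] at h5
        simp [h5]
      · field_simp
  have hmem : ∀ n, Memℓp (fun j => (H n j : ℂ)) 2 := fun n => by
    refine memℓp_gen ?_
    simpa [sq_abs, pow_two] using (hH n n).summable
  refine ⟨fun n => ⟨fun j => (H n j : ℂ), hmem n⟩, ?_, fun j => ?_⟩
  · rw [orthonormal_iff_ite]
    intro m n
    refine (lp.hasSum_inner _ _).unique ?_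
    have h2 : HasSum (fun j => ((H m j * H n j : ℝ) : ℂ)) ((if m = n then 1 else 0 : ℝ) : ℂ) :=
      Complex.hasSum_ofReal.2 (hH m n)
    rw [apply_ite Complex.ofReal, Complex.ofReal_one, Complex.ofReal_zero] at h2
    have h3 : ∀ j, ⟪(H m j : ℂ), (H n j : ℂ)⟫_ℂ = ((H m j * H n j : ℝ) : ℂ) := fun j => by
      simp [mul_comm]
    simp only [h3]
    exact h2
  · have h2 : ∀ n, ‖(H n j : ℂ)‖ ^ 2 = H n j ^ 2 := fun n => by simp
    change ∑ n, ‖(H n j : ℂ)‖ ^ 2 = lam j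
    simp only [h2]
    by_cases hj : j ∈ F
    · simpa [H, hj] using hG2 (some ⟨j, hj⟩)
    · simp only [H, hj, dif_neg, not_false_eq_true, mul_pow, ← Finset.mul_sum, hr2]
      rw [Real.sq_sqrt (div_nonneg (h0 j) hr0)]
      by_cases hrz : r = 0
      · -- Without remainder there is no weight outside `F`.
        have h3 := le_hasSum hout j fun i _ => by split_ifs <;> simp [h0]
        rw [if_neg hj, hrz] at h3
        rw [hrz, mul_zero, le_antisymm h3 (h0 j)]
      · field_simp

/-! ### Spectral decomposition of positive trace-class operators -/

section Spectral

universe u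

variable {H : Type u} [NormedAddCommGroup H] [InnerProductSpace ℂ H] [CompleteSpace H]

omit [CompleteSpace H] in
lemma norm_sub_sum_inner_smul_sq {ι : Type*} {v : ι → H} (hv : Orthonormal ℂ v) (F : Finset ι)
    (x : H) :
    ‖x - ∑ i ∈ F, ⟪v i, x⟫_ℂ • v i‖ ^ 2 = ‖x‖ ^ 2 - ∑ i ∈ F, ‖⟪v i, x⟫_ℂ‖ ^ 2 := by
  have h1 : ⟪x, ∑ i ∈ F, ⟪v i, x⟫_ℂ • v i⟫_ℂ = ((∑ i ∈ F, ‖⟪v i, x⟫_ℂ‖ ^ 2 : ℝ) : ℂ) := by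
    rw [inner_sum]
    push_cast
    refine Finset.sum_congr rfl fun i _ => ?_
    rw [inner_smul_right, ← inner_conj_symm x, Complex.mul_conj']
  have h2 : ⟪∑ i ∈ F, ⟪v i, x⟫_ℂ • v i, ∑ i ∈ F, ⟪v i, x⟫_ℂ • v i⟫_ℂ =
      ((∑ i ∈ F, ‖⟪v i, x⟫_ℂ‖ ^ 2 : ℝ) : ℂ) := by
    rw [hv.inner_sum]
    push_cast
    exact Finset.sum_congr rfl fun i _ => Complex.conj_mul' _
  rw [norm_sub_sq (𝕜 := ℂ), h1, norm_sq_eq_re_inner (𝕜 := ℂ) (∑ i ∈ F, ⟪v i, x⟫_ℂ • v i), h2]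
  simp only [RCLike.re_eq_complex_re, Complex.ofReal_re]
  ring

omit [CompleteSpace H] in
lemma hasSum_norm_inner_sq {ι : Type*} (b : HilbertBasis ι ℂ H) (x : H) :
    HasSum (fun i => ‖⟪b i, x⟫_ℂ‖ ^ 2) (‖x‖ ^ 2) := by
  convert Complex.hasSum_re (b.hasSum_inner_mul_inner x x) using 1
  · funext i
    rw [← inner_conj_symm x, Complex.conj_mul']
    norm_cast
  · exact norm_sq_eq_re_inner (𝕜 := ℂ) x

/-- A positive operator of finite trace is compact: its square root `S` is Hilbert–Schmidt, hence
the norm limit of the finite-rank operators `P_F S`, where `P_F` projects onto finitely many basis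
vectors. -/
lemma isCompactOperator_of_hasTrace {A : H →L[ℂ] H} (hA : 0 ≤ A) {t : ℂ} (ht : HasTrace A t) :
    IsCompactOperator A := by
  obtain ⟨w, b, -⟩ := exists_hilbertBasis ℂ H
  set S := CFC.sqrt A with hS
  have hSS : S * S = A := CFC.sqrt_mul_sqrt_self A hA
  have hadj : ContinuousLinearMap.adjoint S = S :=
    (IsSelfAdjoint.of_nonneg (CFC.sqrt_nonneg A) : star S = S)
  have hmove : ∀ x y, ⟪S x, y⟫_ℂ = ⟪x, S y⟫_ℂ := fun x y => by
    rw [← ContinuousLinearMap.adjoint_inner_right, hadj]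
  have hsum : HasSum (fun i => ‖S (b i)‖ ^ 2) t.re := by
    convert Complex.hasSum_re (ht w b) using 1
    funext i
    rw [← hSS, mul_apply_eq_comp, ← hmove]
    exact norm_sq_eq_re_inner (𝕜 := ℂ) _
  let P : Finset w → H →L[ℂ] H := fun F => ∑ i ∈ F, InnerProductSpace.rankOne ℂ (b i) (b i)
  have hP : ∀ F x, P F x = ∑ i ∈ F, ⟪b i, x⟫_ℂ • b i := fun F x => by
    simp [P]
  have hbound : ∀ F, ‖S - P F ∘L S‖ ≤ Real.sqrt (t.re - ∑ i ∈ F, ‖S (b i)‖ ^ 2) := by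
    intro F
    refine ContinuousLinearMap.opNorm_le_bound _ (Real.sqrt_nonneg _) fun y => ?_
    have hpos : 0 ≤ t.re - ∑ i ∈ F, ‖S (b i)‖ ^ 2 :=
      sub_nonneg.2 (sum_le_hasSum F (fun i _ => by positivity) hsum)
    refine le_of_sq_le_sq ?_ (by positivity)
    rw [mul_pow, Real.sq_sqrt hpos]
    have h1 : HasSum (fun i => ‖⟪b i, S y⟫_ℂ‖ ^ 2) (‖S y‖ ^ 2) := hasSum_norm_inner_sq b _
    have h2 : ‖(S - P F ∘L S) y‖ ^ 2 = ‖S y‖ ^ 2 - ∑ i ∈ F, ‖⟪b i, S y⟫_ℂ‖ ^ 2 := by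
      rw [← norm_sub_sum_inner_smul_sq b.orthonormal, ← hP]
      rfl
    rw [h2]
    have h3 := sum_le_hasSum F (f := fun i => ‖S (b i)‖ ^ 2 * ‖y‖ ^ 2 - ‖⟪b i, S y⟫_ℂ‖ ^ 2)
      (fun i _ => by
        rw [sub_nonneg, ← mul_pow, ← hmove]
        gcongr
        exact norm_inner_le_norm _ _) ((hsum.mul_right _).sub h1)
    rw [Finset.sum_sub_distrib, ← Finset.sum_mul] at h3
    linarith
  have hlim : Filter.Tendsto (fun F => P F ∘L S) Filter.atTop (nhds S) := by
    rw [tendsto_iff_norm_sub_tendsto_zero]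
    refine squeeze_zero (fun _ => norm_nonneg _)
      (fun F => (norm_sub_rev _ _).trans_le (hbound F)) ?_
    have h1 : Filter.Tendsto (fun F => t.re - ∑ i ∈ F, ‖S (b i)‖ ^ 2) Filter.atTop
        (nhds (t.re - t.re)) :=
      Filter.Tendsto.sub tendsto_const_nhds hsum
    simpa using h1.sqrt
  have hcomp : IsCompactOperator S := by
    refine isClosed_setOfPred_isCompactOperator.mem_of_tendsto hlim
      (Filter.Eventually.of_forall fun F => ?_)
    have h1 : P F ∈ compactOperator (RingHom.id ℂ) H H := by
      refine Submodule.sum_mem _ fun i _ => ?_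
      exact (isCompactOperator_of_locallyCompactSpace_dom (innerSL ℂ (b i))).clm_comp
        (ContinuousLinearMap.toSpanSingleton ℂ (b i))
    exact IsCompactOperator.comp_clm h1 S
  rw [← hSS]
  exact hcomp.comp_clm S

/-- A positive operator of finite trace has a Hilbert basis of eigenvectors. -/
lemma exists_hilbertBasis_eigenvectors {A : H →L[ℂ] H} (hA : 0 ≤ A) {t : ℂ} (ht : HasTrace A t) :
    ∃ (ι : Type u) (b : HilbertBasis ι ℂ H) (lam : ι → ℝ), (∀ i, A (b i) = (lam i : ℂ) • b i) ∧
      (∀ i, 0 ≤ lam i) := by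
  have hpos : A.IsPositive := (ContinuousLinearMap.nonneg_iff_isPositive A).1 hA
  have hsym : (A : H →ₗ[ℂ] H).IsSymmetric := hpos.isSymmetric
  have hbot := ContinuousLinearMap.orthogonalComplement_iSup_eigenspaces_eq_bot
    (isCompactOperator_of_hasTrace hA ht) hsym
  have hcomplete : ∀ μ : ℂ, CompleteSpace (Module.End.eigenspace (A : H →ₗ[ℂ] H) μ) :=
    fun μ => by
    have h1 : IsClosed (Module.End.eigenspace (A : H →ₗ[ℂ] H) μ : Set H) := by
      have h2 : (Module.End.eigenspace (A : H →ₗ[ℂ] H) μ : Set H) = {x | A x = μ • x} := by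
        ext x
        exact Module.End.mem_eigenspace_iff
      rw [h2]
      exact isClosed_eq (by fun_prop) (by fun_prop)
    exact h1.completeSpace_coe
  choose w b hb using fun μ : ℂ => exists_hilbertBasis ℂ (Module.End.eigenspace (A : H →ₗ[ℂ] H) μ)
  have hon : Orthonormal ℂ fun a : Σ μ, w μ =>
      ((b a.1 a.2 : Module.End.eigenspace (A : H →ₗ[ℂ] H) a.1) : H) :=
    hsym.orthogonalFamily_eigenspaces.orthonormal_sigma_orthonormal fun μ => (b μ).orthonormal
  have hspan : (Submodule.span ℂ (Set.range fun a : Σ μ, w μ =>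
      ((b a.1 a.2 : Module.End.eigenspace (A : H →ₗ[ℂ] H) a.1) : H)))ᗮ = ⊥ := by
    rw [eq_bot_iff, ← hbot]
    intro x hx
    rw [Submodule.mem_orthogonal] at hx
    rw [← Submodule.iInf_orthogonal, Submodule.mem_iInf]
    intro μ y hy
    have h1 := ((b μ).hasSum_repr ⟨y, hy⟩).mapL
      (innerSL ℂ x ∘L (Module.End.eigenspace (A : H →ₗ[ℂ] H) μ).subtypeL)
    have h2 : ⟪x, y⟫_ℂ = 0 := by
      refine h1.unique ?_
      convert hasSum_zero using 1
      funext i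
      have h3 := hx _ (Submodule.subset_span ⟨⟨μ, i⟩, rfl⟩)
      rw [map_smul]
      change _ • ⟪x, ((b μ i : Module.End.eigenspace (A : H →ₗ[ℂ] H) μ) : H)⟫_ℂ = 0
      rw [inner_eq_zero_symm.1 h3, smul_zero]
    exact inner_eq_zero_symm.1 h2
  let B := HilbertBasis.mkOfOrthogonalEqBot hon hspan
  have hB : ∀ a, B a = ((b a.1 a.2 : Module.End.eigenspace (A : H →ₗ[ℂ] H) a.1) : H) := fun a => by
    simp [B]
  have heig : ∀ a, A (B a) = a.1 • B a := fun a => by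
    rw [hB]
    exact Module.End.mem_eigenspace_iff.1 (b a.1 a.2).2
  have hlam : ∀ a : Σ μ, w μ, ⟪B a, A (B a)⟫_ℂ = a.1 := fun a => by
    rw [heig, inner_smul_right, inner_self_eq_norm_sq_to_K, B.orthonormal.1]
    simp
  have him : ∀ a : Σ μ, w μ, (a.1.re : ℂ) = a.1 := fun a => by
    rw [← Complex.conj_eq_iff_re, ← hlam, inner_conj_symm]
    exact hsym _ _
  refine ⟨_, B, fun a => a.1.re, fun a => by rw [heig, him], fun a => ?_⟩
  have h1 : 0 ≤ RCLike.re ⟪B a, A (B a)⟫_ℂ := hpos.re_inner_nonneg_right _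
  rwa [hlam a] at h1

/-- An operator `0 ≤ A ≤ 1` of finite trace is diagonal in an orthonormal family with weights in
`(0, 1]` that add up to its trace. The family can be indexed by a set of natural numbers, also on a
non-separable space, because only countably many weights of a summable family are nonzero. -/
theorem exists_spectral_decomposition {A : H →L[ℂ] H} (hA : 0 ≤ A) (hA1 : A ≤ 1) {t : ℝ}
    (ht : HasTrace A (t : ℂ)) :
    ∃ (J : Set ℕ) (f : J → H) (lam : J → ℝ), Orthonormal ℂ f ∧ (∀ j, 0 < lam j) ∧
      (∀ j, lam j ≤ 1) ∧ HasSum lam t ∧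
      ∀ x, HasSum (fun j => ((lam j : ℂ) * ⟪f j, x⟫_ℂ) • f j) (A x) := by
  obtain ⟨ι, b, lam, heig, hnn⟩ := exists_hilbertBasis_eigenvectors hA ht
  have hin : ∀ i, ⟪b i, A (b i)⟫_ℂ = lam i := fun i => by
    rw [heig, inner_smul_right, inner_self_eq_norm_sq_to_K, b.orthonormal.1]
    simp
  have hsum : HasSum lam t := by
    have h1 := Complex.hasSum_re (ht ι b)
    simpa only [hin, Complex.ofReal_re] using h1
  have hle : ∀ i, lam i ≤ 1 := fun i => by
    have h1 : 0 ≤ RCLike.re ⟪b i, (1 - A) (b i)⟫_ℂ :=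
      ((ContinuousLinearMap.le_def _ _).1 hA1).re_inner_nonneg_right _
    rw [sub_apply, inner_sub_right, hin] at h1
    have h2 : ⟪b i, (1 : H →L[ℂ] H) (b i)⟫_ℂ = 1 := by
      change ⟪b i, b i⟫_ℂ = 1
      rw [inner_self_eq_norm_sq_to_K, b.orthonormal.1]
      simp
    rw [h2] at h1
    simpa using h1
  have hcount : (Function.support lam).Countable := hsum.summable.countable_support
  obtain ⟨e, he⟩ := (Set.countable_iff_exists_injective).1 hcount
  let E := Equiv.ofInjective e he
  have hc : ∀ j, Function.support lam (E.symm j) := fun j => (E.symm j).2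
  refine ⟨Set.range e, fun j => b (E.symm j), fun j => lam (E.symm j),
    b.orthonormal.comp _ (Subtype.val_injective.comp E.symm.injective),
    fun j => lt_of_le_of_ne (hnn _) (Ne.symm (hc j)), fun j => hle _, ?_, fun x => ?_⟩
  · rw [← hasSum_subtype_support, ← E.symm.hasSum_iff] at hsum
    exact hsum
  · have h1 : HasSum (fun i => ((lam i : ℂ) * ⟪b i, x⟫_ℂ) • b i) (A x) := by
      convert (b.hasSum_repr x).mapL A using 1
      funext i
      rw [map_smul, heig, b.repr_apply_apply, smul_smul, mul_comm]
    rw [← hasSum_subtype_iff_of_support_subset (s := Function.support lam),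
      ← E.symm.hasSum_iff] at h1
    · exact h1
    · refine Function.support_subset_iff'.2 fun i hi => ?_
      rw [Function.notMem_support.1 hi]
      simp

end Spectral

/-! ### Creation and annihilation on Slater determinants -/

section Slater

universe u

variable {h : Type u} [NormedAddCommGroup h] [InnerProductSpace ℂ h]

lemma creation_coe (f : h) (x : ExteriorAlgebra ℂ h) :
    creation f (x : Fock h) = ((ExteriorAlgebra.ι ℂ f * x : ExteriorAlgebra ℂ h) : Fock h) :=
  ContinuousLinearMap.completion_apply_coe _ _

lemma inner_coe_coe (x y : ExteriorAlgebra ℂ h) : ⟪(x : Fock h), (y : Fock h)⟫_ℂ = algInner x y :=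
  UniformSpace.Completion.inner_coe x y

lemma annihilation_coe (f : h) (x : ExteriorAlgebra ℂ h) :
    annihilation f (x : Fock h) = (algAnnihilation f x : Fock h) := by
  refine ext_inner_left ℂ fun ψ => ?_
  induction ψ using UniformSpace.Completion.induction_on with
  | hp => exact isClosed_eq (by fun_prop) (by fun_prop)
  | ih y =>
    rw [annihilation, ContinuousLinearMap.adjoint_inner_right, creation_coe, inner_coe_coe,
      inner_coe_coe, algInner_creation_left]

lemma norm_creation_le (f : h) : ‖creation f‖ ≤ ‖f‖ := by
  refine ContinuousLinearMap.opNorm_le_bound _ (norm_nonneg _) fun ψ => ?_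
  induction ψ using UniformSpace.Completion.induction_on with
  | hp => exact isClosed_le (by fun_prop) (by fun_prop)
  | ih y =>
    rw [creation_coe, UniformSpace.Completion.norm_coe, UniformSpace.Completion.norm_coe]
    exact norm_algCreation_le f y

lemma creation_sub (f g : h) : creation (f - g) = creation f - creation g := by
  ext ψ
  induction ψ using UniformSpace.Completion.induction_on with
  | hp => exact isClosed_eq (by fun_prop) (by fun_prop)
  | ih y =>
    rw [sub_apply, creation_coe, creation_coe, creation_coe, map_sub, sub_mul]
    exact UniformSpace.Completion.coe_sub _ _

lemma continuous_creation : Continuous (creation : h → Fock h →L[ℂ] Fock h) := by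
  refine (LipschitzWith.of_dist_le_mul (K := 1) fun f g => ?_).continuous
  rw [dist_eq_norm, dist_eq_norm, ← creation_sub, NNReal.coe_one, one_mul]
  exact norm_creation_le _

lemma wedge_succ {n : ℕ} (f : Fin (n + 1) → h) :
    wedge f = creation (f 0) (wedge fun i => f i.succ) := by
  rw [wedge, wedge, creation_coe, ExteriorAlgebra.ιMulti_succ_apply]
  rfl

lemma continuous_wedge (n : ℕ) : Continuous (wedge : (Fin n → h) → Fock h) := by
  induction n with
  | zero =>
    have h1 : (wedge : (Fin 0 → h) → Fock h) = fun _ => wedge ![] :=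
      funext fun f => congrArg wedge (Subsingleton.elim _ _)
    rw [h1]
    exact continuous_const
  | succ n ih =>
    have h1 : (wedge : (Fin (n + 1) → h) → Fock h) =
        fun f => creation (f 0) (wedge fun i => f i.succ) := funext wedge_succ
    rw [h1]
    have h2 : Continuous fun f : Fin (n + 1) → h => creation (f 0) :=
      continuous_creation.comp (continuous_apply 0)
    exact h2.clm_apply (ih.comp (by fun_prop))

lemma algAnnihilation_ιMulti_eq_zero {n : ℕ} {e : h} {f : Fin n → h} (he : ∀ i, ⟪e, f i⟫_ℂ = 0) :
    algAnnihilation e (ExteriorAlgebra.ιMulti ℂ n f) = 0 := by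
  induction n with
  | zero => rw [ExteriorAlgebra.ιMulti_zero_apply, algAnnihilation_one]
  | succ n ih =>
    rw [ExteriorAlgebra.ιMulti_succ_apply, algAnnihilation_ι_mul, he,
      ih (f := Matrix.vecTail f) fun i => he i.succ]
    simp

lemma algInner_ιMulti_self {n : ℕ} {f : Fin n → h} (hf : Orthonormal ℂ f) :
    algInner (ExteriorAlgebra.ιMulti ℂ n f) (ExteriorAlgebra.ιMulti ℂ n f) = 1 := by
  induction n with
  | zero => rw [ExteriorAlgebra.ιMulti_zero_apply, algInner_one_left, map_one]
  | succ n ih =>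
    rw [ExteriorAlgebra.ιMulti_succ_apply, algInner_creation_left, algAnnihilation_ι_mul,
      algAnnihilation_ιMulti_eq_zero (e := f 0), mul_zero, sub_zero, algInner_smul_right]
    · have h1 := ih (hf.comp _ (Fin.succ_injective n))
      change ⟪f 0, f 0⟫_ℂ * algInner (ExteriorAlgebra.ιMulti ℂ n (f ∘ Fin.succ))
        (ExteriorAlgebra.ιMulti ℂ n (f ∘ Fin.succ)) = 1
      rw [h1, inner_self_eq_norm_sq_to_K, hf.1]
      simp
    · exact fun i => hf.2 (Fin.succ_ne_zero i).symm

/-- The one-particle reduced density matrix of a Slater determinant is the projection onto the span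
of its orbitals. -/
lemma algInner_algAnnihilation_ιMulti {n : ℕ} {f : Fin n → h} (hf : Orthonormal ℂ f) (y z : h) :
    algInner (algAnnihilation y (ExteriorAlgebra.ιMulti ℂ n f))
      (algAnnihilation z (ExteriorAlgebra.ιMulti ℂ n f)) = ∑ i, ⟪z, f i⟫_ℂ * ⟪f i, y⟫_ℂ := by
  have z1 : ∀ x : ExteriorAlgebra ℂ h, algInner x 0 = 0 := fun x => by simp [algInner]
  have z2 : ∀ x : ExteriorAlgebra ℂ h, algInner 0 x = 0 := fun x => by
    rw [← algInner_conj_symm, z1, map_zero]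
  induction n with
  | zero => simp [ExteriorAlgebra.ιMulti_zero_apply, algAnnihilation_one, z1]
  | succ n ih =>
    have hf' : Orthonormal ℂ fun i : Fin n => f i.succ := hf.comp _ (Fin.succ_injective n)
    have h1 := algInner_ιMulti_self hf'
    have h2 := ih hf'
    have h3 : algAnnihilation (f 0) (ExteriorAlgebra.ιMulti ℂ n fun i => f i.succ) = 0 :=
      algAnnihilation_ιMulti_eq_zero fun i => hf.2 (Fin.succ_ne_zero i).symm
    rw [ExteriorAlgebra.ιMulti_succ_apply, Fin.sum_univ_succ, ← h2]
    change algInner (algAnnihilation y (_ * ExteriorAlgebra.ιMulti ℂ n fun i => f i.succ))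
      (algAnnihilation z (_ * ExteriorAlgebra.ιMulti ℂ n fun i => f i.succ)) = _
    set x := ExteriorAlgebra.ιMulti ℂ n fun i => f i.succ
    -- `c(f₀)` kills everything generated by the other orbitals.
    have h4 : ∀ v, algAnnihilation (f 0) (algAnnihilation v x) = 0 := fun v => by
      have h5 := CliffordAlgebra.contractLeft_comm (Q := (0 : QuadraticForm ℂ h))
        (innerₛₗ ℂ (f 0)) (innerₛₗ ℂ v) x
      refine h5.trans ?_
      change -algAnnihilation v (algAnnihilation (f 0) x) = 0
      rw [h3, map_zero, neg_zero]
    have hff : ⟪f 0, f 0⟫_ℂ = 1 := by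
      rw [inner_self_eq_norm_sq_to_K, hf.1]
      simp
    rw [algAnnihilation_ι_mul, algAnnihilation_ι_mul, algInner_sub_right, sub_eq_add_neg
      (⟪y, f 0⟫_ℂ • x), ← neg_one_smul ℂ (ExteriorAlgebra.ι ℂ (f 0) * _), algInner_add_left,
      algInner_add_left, algInner_smul_left, algInner_smul_left, algInner_smul_left,
      algInner_smul_left, algInner_smul_right, algInner_smul_right, algInner_creation_left,
      algInner_creation_left, algInner_creation_right, algAnnihilation_ι_mul, h3, h4, h1, z1, z2,
      hff, inner_conj_symm]
    simp
    ring

lemma algAnnihilation_ιMulti_succ_mem (n : ℕ) (e : h) (f : Fin (n + 1) → h) :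
    algAnnihilation e (ExteriorAlgebra.ιMulti ℂ (n + 1) f) ∈
      Submodule.span ℂ (Set.range (ExteriorAlgebra.ιMulti ℂ (M := h) n)) := by
  induction n with
  | zero =>
    rw [ExteriorAlgebra.ιMulti_succ_apply, algAnnihilation_ι_mul, ExteriorAlgebra.ιMulti_zero_apply,
      algAnnihilation_one, mul_zero, sub_zero]
    refine Submodule.smul_mem _ _ (Submodule.subset_span ⟨![], ?_⟩)
    rw [ExteriorAlgebra.ιMulti_zero_apply]
  | succ n ih =>
    rw [ExteriorAlgebra.ιMulti_succ_apply, algAnnihilation_ι_mul]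
    refine sub_mem (Submodule.smul_mem _ _ (Submodule.subset_span ⟨_, rfl⟩)) ?_
    have h1 := ih fun i => f i.succ
    change ExteriorAlgebra.ι ℂ (f 0) * algAnnihilation e
      (ExteriorAlgebra.ιMulti ℂ (n + 1) fun i => f i.succ) ∈ _
    generalize algAnnihilation e (ExteriorAlgebra.ιMulti ℂ (n + 1) fun i => f i.succ) = z at h1 ⊢
    induction h1 using Submodule.span_induction with
    | mem x hx =>
      obtain ⟨g, rfl⟩ := hx
      refine Submodule.subset_span ⟨Fin.cons (f 0) g, ?_⟩
      rw [ExteriorAlgebra.ιMulti_succ_apply]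
      rfl
    | zero => simp
    | add a b _ _ ha hb => rw [mul_add]; exact add_mem ha hb
    | smul c a _ ha => rw [mul_smul_comm]; exact Submodule.smul_mem _ _ ha

lemma algInner_ιMulti_of_ne {m n : ℕ} (hmn : m ≠ n) (f : Fin m → h) (g : Fin n → h) :
    algInner (ExteriorAlgebra.ιMulti ℂ m f) (ExteriorAlgebra.ιMulti ℂ n g) = 0 := by
  induction m generalizing n with
  | zero =>
    obtain ⟨k, rfl⟩ := Nat.exists_eq_succ_of_ne_zero hmn.symm
    rw [ExteriorAlgebra.ιMulti_zero_apply, algInner_one_left, ExteriorAlgebra.ιMulti_succ_apply,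
      algebraMapInv_ι_mul]
  | succ m ih =>
    rw [ExteriorAlgebra.ιMulti_succ_apply, algInner_creation_left]
    cases n with
    | zero =>
      rw [ExteriorAlgebra.ιMulti_zero_apply, algAnnihilation_one]
      simp [algInner]
    | succ n =>
      have h1 := algAnnihilation_ιMulti_succ_mem n (f 0) g
      generalize algAnnihilation (f 0) (ExteriorAlgebra.ιMulti ℂ (n + 1) g) = z at h1 ⊢
      induction h1 using Submodule.span_induction with
      | mem x hx =>
        obtain ⟨g', rfl⟩ := hx
        exact ih (by omega) _ _
      | zero => simp [algInner]
      | add a b _ _ ha hb => rw [algInner_add_right, ha, hb, add_zero]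
      | smul c a _ ha => rw [algInner_smul_right, ha, mul_zero]

lemma norm_wedge {n : ℕ} {f : Fin n → h} (hf : Orthonormal ℂ f) : ‖wedge f‖ = 1 := by
  have h1 : ⟪wedge f, wedge f⟫_ℂ = 1 := (inner_coe_coe _ _).trans (algInner_ιMulti_self hf)
  have h2 : ‖wedge f‖ ^ 2 = 1 := by
    rw [norm_sq_eq_re_inner (𝕜 := ℂ), h1]
    simp
  exact (pow_eq_one_iff_of_nonneg (norm_nonneg _) two_ne_zero).1 h2

lemma inner_annihilation_wedge {n : ℕ} {f : Fin n → h} (hf : Orthonormal ℂ f) (y z : h) :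
    ⟪annihilation y (wedge f), annihilation z (wedge f)⟫_ℂ = ∑ i, ⟪z, f i⟫_ℂ * ⟪f i, y⟫_ℂ := by
  rw [wedge, annihilation_coe, annihilation_coe, inner_coe_coe, algInner_algAnnihilation_ιMulti hf]

/-- Different particle-number sectors are orthogonal. -/
lemma inner_sector_of_ne {m n : ℕ} (hmn : m ≠ n) {φ ψ : Fock h} (hφ : φ ∈ sector h m)
    (hψ : ψ ∈ sector h n) : ⟪φ, ψ⟫_ℂ = 0 := by
  have h1 : sector h m ≤ (sector h n)ᗮ := by
    rw [sector, sector, Submodule.orthogonal_closure]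
    refine Submodule.topologicalClosure_minimal _ ?_ (Submodule.isClosed_orthogonal _)
    refine Submodule.isOrtho_span.2 ?_
    rintro _ ⟨f, rfl⟩ _ ⟨g, rfl⟩
    exact (inner_coe_coe _ _).trans (algInner_ιMulti_of_ne hmn f g)
  exact inner_eq_zero_symm.1 (h1 hφ ψ hψ)

end Slater

/-! ### Averages of rank-one operators -/

section Average

universe u

variable {H : Type u} [NormedAddCommGroup H] [InnerProductSpace ℂ H] [CompleteSpace H]
  {X : Type*} [TopologicalSpace X] [CompactSpace X] [MeasurableSpace X] [OpensMeasurableSpace X]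

omit [MeasurableSpace X] [OpensMeasurableSpace X] [CompleteSpace H] in
/-- The expansion of a compact family of vectors in a Hilbert basis converges uniformly
(Dini's theorem for the remainders `‖Ψ x‖² - ∑ |⟪bᵢ, Ψ x⟫|²`). -/
lemma eventually_norm_sub_sum_lt {ι : Type*} (b : HilbertBasis ι ℂ H) {Ψ : X → H}
    (hΨ : Continuous Ψ) {ε : ℝ} (hε : 0 < ε) :
    ∀ᶠ F : Finset ι in Filter.atTop, ∀ x, ‖Ψ x - ∑ i ∈ F, ⟪b i, Ψ x⟫_ℂ • b i‖ < ε := by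
  have h1 : TendstoUniformly (fun (F : Finset ι) x => ‖Ψ x - ∑ i ∈ F, ⟪b i, Ψ x⟫_ℂ • b i‖ ^ 2)
      (fun _ => (0 : ℝ)) Filter.atTop := by
    refine Antitone.tendstoUniformly_of_forall_tendsto (fun F => by fun_prop) ?_
      continuous_const fun x => ?_
    · intro F F' hF x
      simp only [norm_sub_sum_inner_smul_sq b.orthonormal]
      exact sub_le_sub_left (Finset.sum_le_sum_of_subset_of_nonneg hF fun _ _ _ => by positivity) _
    · simp only [norm_sub_sum_inner_smul_sq b.orthonormal]
      rw [← sub_self (‖Ψ x‖ ^ 2)]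
      exact tendsto_const_nhds.sub (hasSum_norm_inner_sq b (Ψ x))
  filter_upwards [Metric.tendstoUniformly_iff.1 h1 (ε ^ 2) (by positivity)] with F hF x
  have h2 := hF x
  rw [dist_zero_left, Real.norm_of_nonneg (by positivity)] at h2
  exact lt_of_pow_lt_pow_left₀ 2 hε.le h2

lemma integrable_of_continuous {E : Type*} [NormedAddCommGroup E] {f : X → E}
    (hf : Continuous f) (μ : Measure X) [IsFiniteMeasure μ] : Integrable f μ :=
  hf.integrable_of_hasCompactSupport (HasCompactSupport.of_compactSpace f)

variable (μ : Measure X) [IsProbabilityMeasure μ]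

omit [CompleteSpace H] in
/-- Parseval's identity under the integral sign, for an arbitrary Hilbert basis. -/
lemma hasSum_integral_inner_mul_inner {ι : Type*} (b : HilbertBasis ι ℂ H) {Φ Ψ : X → H}
    (hΦ : Continuous Φ) (hΨ : Continuous Ψ) :
    HasSum (fun i => ∫ x, ⟪Φ x, b i⟫_ℂ * ⟪b i, Ψ x⟫_ℂ ∂μ) (∫ x, ⟪Φ x, Ψ x⟫_ℂ ∂μ) := by
  obtain ⟨C, hC⟩ : ∃ C : ℝ, ∀ x, ‖Φ x‖ ≤ C := by
    obtain ⟨C, hC⟩ := (isCompact_range hΦ).isBounded.exists_norm_le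
    exact ⟨C, fun x => hC _ ⟨x, rfl⟩⟩
  have hC' : 0 < |C| + 1 := by positivity
  rw [HasSum, SummationFilter.unconditional_filter, Metric.tendsto_nhds]
  intro ε hε
  filter_upwards [eventually_norm_sub_sum_lt b hΨ (div_pos hε hC')] with F hF
  have hint : ∀ i ∈ F, Integrable (fun x => ⟪Φ x, b i⟫_ℂ * ⟪b i, Ψ x⟫_ℂ) μ := fun i _ =>
    integrable_of_continuous (by fun_prop) μ
  rw [← integral_finsetSum _ hint, dist_comm, dist_eq_norm, ← integral_sub
    (integrable_of_continuous (by fun_prop) μ)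
    (integrable_of_continuous (by fun_prop) μ)]
  have h1 : ∀ x, ‖⟪Φ x, Ψ x⟫_ℂ - ∑ i ∈ F, ⟪Φ x, b i⟫_ℂ * ⟪b i, Ψ x⟫_ℂ‖ ≤
      |C| * (ε / (|C| + 1)) := fun x => by
    have h2 : ⟪Φ x, Ψ x⟫_ℂ - ∑ i ∈ F, ⟪Φ x, b i⟫_ℂ * ⟪b i, Ψ x⟫_ℂ =
        ⟪Φ x, Ψ x - ∑ i ∈ F, ⟪b i, Ψ x⟫_ℂ • b i⟫_ℂ := by
      rw [inner_sub_right, inner_sum]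
      simp only [inner_smul_right, mul_comm]
    rw [h2]
    exact (norm_inner_le_norm _ _).trans (mul_le_mul ((hC x).trans (le_abs_self C)) (hF x).le
      (norm_nonneg _) (abs_nonneg C))
  have h3 := norm_integral_le_of_norm_le_const (μ := μ) (Filter.Eventually.of_forall h1)
  rw [probReal_univ, mul_one] at h3
  refine h3.trans_lt ?_
  rw [mul_div_assoc', div_lt_iff₀ hC']
  nlinarith

variable {Ψ : X → H}

lemma integral_rankOne_apply (hΨ : Continuous Ψ) (ψ : H) :
    (∫ x, InnerProductSpace.rankOne ℂ (Ψ x) (Ψ x) ∂μ) ψ = ∫ x, ⟪Ψ x, ψ⟫_ℂ • Ψ x ∂μ := by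
  have h1 : Continuous fun x => InnerProductSpace.rankOne ℂ (Ψ x) (Ψ x) := by
    simp only [InnerProductSpace.rankOne_def]
    exact (ContinuousLinearMap.continuous₂ (ContinuousLinearMap.smulRightL ℂ H H)).comp
      (((innerSL ℂ (E := H)).continuous.comp hΨ).prodMk hΨ)
  rw [ContinuousLinearMap.integral_apply (integrable_of_continuous h1 μ)]
  rfl

lemma inner_integral_rankOne (hΨ : Continuous Ψ) (φ ψ : H) :
    ⟪φ, (∫ x, InnerProductSpace.rankOne ℂ (Ψ x) (Ψ x) ∂μ) ψ⟫_ℂ =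
      ∫ x, ⟪φ, Ψ x⟫_ℂ * ⟪Ψ x, ψ⟫_ℂ ∂μ := by
  rw [integral_rankOne_apply μ hΨ, ← integral_inner
    (integrable_of_continuous (by fun_prop) μ)]
  simp only [inner_smul_right, mul_comm]

lemma hasTrace_integral_rankOne_comp (hΨ : Continuous Ψ) (B : H →L[ℂ] H) :
    HasTrace ((∫ x, InnerProductSpace.rankOne ℂ (Ψ x) (Ψ x) ∂μ) ∘L B)
      (∫ x, ⟪Ψ x, B (Ψ x)⟫_ℂ ∂μ) := by
  intro ι b
  have h1 := hasSum_integral_inner_mul_inner μ b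
    ((ContinuousLinearMap.adjoint B).continuous.comp hΨ) hΨ
  simpa only [ContinuousLinearMap.comp_apply, inner_integral_rankOne μ hΨ, Function.comp_apply,
    ContinuousLinearMap.adjoint_inner_left, mul_comm] using h1

lemma integral_rankOne_nonneg (hΨ : Continuous Ψ) :
    0 ≤ ∫ x, InnerProductSpace.rankOne ℂ (Ψ x) (Ψ x) ∂μ := by
  rw [ContinuousLinearMap.nonneg_iff_isPositive, ContinuousLinearMap.isPositive_iff_complex]
  intro ψ
  have h1 : ⟪ψ, (∫ x, InnerProductSpace.rankOne ℂ (Ψ x) (Ψ x) ∂μ) ψ⟫_ℂ =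
      ((∫ x, ‖⟪Ψ x, ψ⟫_ℂ‖ ^ 2 ∂μ : ℝ) : ℂ) := by
    rw [inner_integral_rankOne μ hΨ, ← integral_complex_ofReal]
    refine integral_congr_ae (Filter.Eventually.of_forall fun x => ?_)
    change ⟪ψ, Ψ x⟫_ℂ * ⟪Ψ x, ψ⟫_ℂ = _
    rw [← inner_conj_symm ψ, Complex.conj_mul']
    push_cast
    rfl
  rw [← inner_conj_symm, h1, Complex.conj_ofReal]
  simp only [RCLike.re_eq_complex_re, Complex.ofReal_re, true_and]
  positivity

end Average

/-! ### Phase-averaged orbitals -/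

section Phase

/-- The character `exp (2πi t)`. -/
noncomputable def phase (t : unitInterval) : ℂ := Complex.exp (2 * Real.pi * Complex.I * (t : ℝ))

lemma continuous_phase : Continuous phase := by
  unfold phase
  fun_prop

lemma norm_phase (t : unitInterval) : ‖phase t‖ = 1 := by
  have h1 : (2 * Real.pi * Complex.I * (t : ℝ) : ℂ) = ((2 * Real.pi * t : ℝ) : ℂ) * Complex.I := by
    push_cast
    ring
  rw [phase, h1, Complex.norm_exp_ofReal_mul_I]

lemma integral_phase : ∫ t, phase t = 0 := by
  have h1 := integral_subtype (s := unitInterval) measurableSet_Icc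
    fun t : ℝ => Complex.exp (2 * Real.pi * Complex.I * t)
  refine h1.trans ?_
  rw [unitInterval, integral_Icc_eq_integral_Ioc, ← intervalIntegral.integral_of_le zero_le_one,
    integral_exp_mul_complex Complex.two_pi_I_ne_zero]
  simp [Complex.exp_two_pi_mul_I]

variable {J : Set ℕ}

/-- The uniform distribution of the phases. -/
noncomputable abbrev phaseMeasure (J : Set ℕ) : Measure (J → unitInterval) :=
  Measure.infinitePi fun _ : J => (volume : Measure unitInterval)

open ProbabilityTheory in
/-- Phases of different modes are uncorrelated. -/
lemma integral_phase_mul_conj_phase [DecidableEq J] (j k : J) :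
    ∫ θ, phase (θ j) * conj (phase (θ k)) ∂phaseMeasure J = if j = k then 1 else 0 := by
  split_ifs with hjk
  · subst hjk
    have h1 : ∀ θ : J → unitInterval, phase (θ j) * conj (phase (θ j)) = 1 := fun θ => by
      rw [Complex.mul_conj', norm_phase]
      simp
    simp [h1]
  · have hind : IndepFun (fun θ : J → unitInterval => phase (θ j)) (fun θ => conj (phase (θ k)))
        (phaseMeasure J) := by
      have h1 : iIndepFun (fun (i : J) (θ : J → unitInterval) => id (θ i)) (phaseMeasure J) :=
        iIndepFun_infinitePi fun _ => measurable_id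
      have h2 := (h1.indepFun hjk).comp (φ := phase) (ψ := fun t => conj (phase t))
        continuous_phase.measurable (Complex.continuous_conj.comp continuous_phase).measurable
      exact h2
    rw [hind.integral_fun_mul_eq_mul_integral]
    · have h1 : ∫ θ, phase (θ j) ∂phaseMeasure J = 0 := by
        have h2 := (measurePreserving_eval_infinitePi
          (fun _ : J => (volume : Measure unitInterval)) j).map_eq
        have h3 : ∫ t, phase t ∂((phaseMeasure J).map fun θ => θ j) = 0 := by
          rw [← integral_phase]
          exact congrArg (fun ν => ∫ t, phase t ∂ν) h2
        rwa [integral_map (measurable_pi_apply j).aemeasurable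
          continuous_phase.aestronglyMeasurable] at h3
      rw [h1, zero_mul]
    · exact (continuous_phase.comp (continuous_apply j)).aestronglyMeasurable
    · exact ((Complex.continuous_conj.comp continuous_phase).comp
        (continuous_apply k)).aestronglyMeasurable

/-- Off-diagonal terms of a product of two absolutely convergent phase series average out. -/
lemma hasSum_integral_phase_series {a b : J → ℂ} (ha : Summable fun j => ‖a j‖)
    (hb : Summable fun j => ‖b j‖) :
    HasSum (fun j => a j * b j) (∫ θ, (∑' j, phase (θ j) * a j) * (∑' k, conj (phase (θ k)) * b k)
      ∂phaseMeasure J) := by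
  classical
  let T : J × J → (J → unitInterval) → ℂ := fun p θ =>
    (phase (θ p.1) * a p.1) * (conj (phase (θ p.2)) * b p.2)
  have hT : ∀ p, Continuous (T p) := fun p => by
    have := continuous_phase
    fun_prop
  have hTn : ∀ p θ, ‖T p θ‖ = ‖a p.1‖ * ‖b p.2‖ := fun p θ => by
    simp [T, norm_phase]
  have hsum : Summable fun p : J × J => ‖a p.1‖ * ‖b p.2‖ := ha.mul_of_nonneg hb
    (fun _ => norm_nonneg _) fun _ => norm_nonneg _
  have h1 := hasSum_integral_of_summable_integral_norm (μ := phaseMeasure J) (F := T)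
    (fun p => integrable_of_continuous (hT p) _) (by simpa [hTn] using hsum)
  have h2 : ∀ θ, ∑' p, T p θ =
      (∑' j, phase (θ j) * a j) * (∑' k, conj (phase (θ k)) * b k) := fun θ =>
    (tsum_mul_tsum_of_summable_norm (f := fun j => phase (θ j) * a j)
      (g := fun k => conj (phase (θ k)) * b k) (by simpa [norm_phase] using ha)
      (by simpa [norm_phase] using hb)).symm
  have h3 : ∀ p : J × J, ∫ θ, T p θ ∂phaseMeasure J = if p.1 = p.2 then a p.1 * b p.2 else 0 := by
    intro p
    have h4 : ∀ θ, T p θ = (phase (θ p.1) * conj (phase (θ p.2))) * (a p.1 * b p.2) := fun θ => by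
      simp only [T]
      ring
    simp only [h4, integral_mul_const, integral_phase_mul_conj_phase]
    split_ifs <;> simp
  simp only [h2, h3] at h1
  have hinj : Function.Injective fun j : J => (j, j) := fun j k hjk => (Prod.ext_iff.1 hjk).1
  rw [← hinj.hasSum_iff] at h1
  · simpa [Function.comp_def] using h1
  · rintro ⟨j, k⟩ hjk
    refine if_neg fun h4 => hjk ⟨j, ?_⟩
    simp only at h4
    rw [h4]

end Phase

section Orbitals

universe u

variable {h : Type u} [NormedAddCommGroup h] [InnerProductSpace ℂ h] [CompleteSpace h]
  {J : Set ℕ} {N : ℕ} {f : J → h} (hf : Orthonormal ℂ f) (G : Fin N → lp (fun _ : J => ℂ) 2)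

/-- Multiplication of the coordinates of an element of `ℓ²(J)` by phases. -/
noncomputable def rotate (θ : J → unitInterval) (v : lp (fun _ : J => ℂ) 2) :
    lp (fun _ : J => ℂ) 2 :=
  ⟨fun j => phase (θ j) * v j, (lp.memℓp v).mono' fun j => by simp [norm_phase]⟩

lemma inner_rotate (θ : J → unitInterval) (v w : lp (fun _ : J => ℂ) 2) :
    ⟪rotate θ v, rotate θ w⟫_ℂ = ⟪v, w⟫_ℂ := by
  rw [lp.inner_eq_tsum, lp.inner_eq_tsum]
  refine tsum_congr fun j => ?_
  change ⟪phase (θ j) * v j, phase (θ j) * w j⟫_ℂ = ⟪v j, w j⟫_ℂ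
  have h1 : conj (phase (θ j)) * phase (θ j) = 1 := by
    rw [Complex.conj_mul', norm_phase]
    simp
  simp only [RCLike.inner_apply, map_mul]
  linear_combination (w j * conj (v j)) * h1

lemma continuous_rotate (v : lp (fun _ : J => ℂ) 2) : Continuous fun θ => rotate θ v := by
  rw [continuous_iff_continuousAt]
  intro θ₀
  have hv : Summable fun j => ‖v j‖ ^ 2 := by
    simpa using (lp.memℓp v).summable (by norm_num)
  have h1 : ∀ θ, ‖rotate θ v - rotate θ₀ v‖ ^ 2 =
      ∑' j, ‖phase (θ j) - phase (θ₀ j)‖ ^ 2 * ‖v j‖ ^ 2 := fun θ => by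
    have h2 := lp.norm_rpow_eq_tsum (p := 2) (by norm_num) (rotate θ v - rotate θ₀ v)
    simp only [ENNReal.toReal_ofNat, Real.rpow_ofNat] at h2
    rw [h2]
    refine tsum_congr fun j => ?_
    rw [← mul_pow, ← norm_mul, sub_mul]
    rfl
  have h3 : Continuous fun θ => ‖rotate θ v - rotate θ₀ v‖ ^ 2 := by
    simp only [h1]
    refine continuous_tsum (u := fun j => 4 * ‖v j‖ ^ 2) (fun j => ?_) (hv.mul_left 4) fun j θ => ?_
    · have := continuous_phase
      fun_prop
    · rw [Real.norm_of_nonneg (by positivity)]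
      have h4 : ‖phase (θ j) - phase (θ₀ j)‖ ≤ 2 := by
        refine (norm_sub_le _ _).trans ?_
        rw [norm_phase, norm_phase]
        norm_num
      gcongr
      nlinarith [norm_nonneg (phase (θ j) - phase (θ₀ j))]
  rw [ContinuousAt, tendsto_iff_norm_sub_tendsto_zero]
  have h5 := (h3.sqrt).tendsto θ₀
  simpa using h5

include hf

lemma phaseOrbital_eq (θ : J → unitInterval) (n : Fin N) :
    phaseOrbital f G θ n = hf.orthogonalFamily.linearIsometry (rotate θ (G n)) := rfl

lemma hasSum_phaseOrbital (θ : J → unitInterval) (n : Fin N) :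
    HasSum (fun j => (phase (θ j) * G n j) • f j) (phaseOrbital f G θ n) :=
  hf.orthogonalFamily.hasSum_linearIsometry (rotate θ (G n))

variable {G} in
lemma orthonormal_phaseOrbital (hG : Orthonormal ℂ G) (θ : J → unitInterval) :
    Orthonormal ℂ (phaseOrbital f G θ) := by
  rw [orthonormal_iff_ite] at hG ⊢
  intro m n
  rw [phaseOrbital_eq hf, phaseOrbital_eq hf, LinearIsometry.inner_map_map, inner_rotate, hG]

lemma continuous_phaseOrbital (n : Fin N) : Continuous fun θ => phaseOrbital f G θ n :=
  hf.orthogonalFamily.linearIsometry.continuous.comp (continuous_rotate (G n))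

/-- The average over the phases of the projection onto the orbital `gₙ(θ)` is diagonal in `f`. -/
lemma hasSum_integral_phaseOrbital (n : Fin N) (x y : h) :
    HasSum (fun j => ((‖G n j‖ ^ 2 : ℝ) : ℂ) * (⟪y, f j⟫_ℂ * ⟪f j, x⟫_ℂ))
      (∫ θ, ⟪y, phaseOrbital f G θ n⟫_ℂ * ⟪phaseOrbital f G θ n, x⟫_ℂ ∂phaseMeasure J) := by
  have hGn : Summable fun j => ‖G n j‖ ^ 2 := by
    simpa using (lp.memℓp (G n)).summable (by norm_num)
  have hsum : ∀ z : h, Summable fun j => ‖G n j‖ * ‖⟪f j, z⟫_ℂ‖ := fun z => by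
    refine Summable.of_nonneg_of_le (fun j => by positivity) (fun j => ?_)
      (hGn.add (hf.inner_products_summable (x := z)))
    nlinarith [sq_nonneg (‖G n j‖ - ‖⟪f j, z⟫_ℂ‖), sq_nonneg ‖G n j‖, sq_nonneg ‖⟪f j, z⟫_ℂ‖]
  have h1 := hasSum_integral_phase_series (a := fun j => G n j * ⟪y, f j⟫_ℂ)
    (b := fun j => conj (G n j) * ⟪f j, x⟫_ℂ)
    (by simpa only [norm_mul, norm_inner_symm] using hsum y)
    (by simpa only [norm_mul, RCLike.norm_conj] using hsum x)
  have h2 : ∀ (θ : J → unitInterval) (z : h), HasSum (fun j => phase (θ j) * (G n j * ⟪z, f j⟫_ℂ))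
      ⟪z, phaseOrbital f G θ n⟫_ℂ := fun θ z => by
    have h3 := (hasSum_phaseOrbital hf G θ n).mapL (innerSL ℂ z)
    simpa only [innerSL_apply_apply, inner_smul_right, mul_assoc] using h3
  have h4 : ∀ θ : J → unitInterval,
      HasSum (fun j => conj (phase (θ j)) * (conj (G n j) * ⟪f j, x⟫_ℂ))
      ⟪phaseOrbital f G θ n, x⟫_ℂ := fun θ => by
    have h5 := (h2 θ x).map (starRingEnd ℂ) Complex.continuous_conj
    simpa only [Function.comp_def, map_mul, inner_conj_symm] using h5
  simp only [(h2 _ y).tsum_eq, (h4 _).tsum_eq] at h1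
  convert h1 using 2 with j
  have h6 := Complex.mul_conj' (G n j)
  push_cast
  linear_combination (-(⟪y, f j⟫_ℂ * ⟪f j, x⟫_ℂ)) * h6

end Orbitals

/-! ### The phase-averaged state -/

section State

universe u

variable {h : Type u} [NormedAddCommGroup h] [InnerProductSpace ℂ h]

/-- An average of projections onto unit vectors of the `N`-particle sector is an `N`-particle
density matrix. -/
lemma isNParticleDensityMatrix_integral {X : Type*} [TopologicalSpace X] [CompactSpace X]
    [MeasurableSpace X] [OpensMeasurableSpace X] (μ : Measure X) [IsProbabilityMeasure μ]
    {N : ℕ} {Ψ : X → Fock h} (hΨ : Continuous Ψ) (hnorm : ∀ x, ‖Ψ x‖ = 1)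
    (hsec : ∀ x, Ψ x ∈ sector h N) :
    IsNParticleDensityMatrix N (∫ x, InnerProductSpace.rankOne ℂ (Ψ x) (Ψ x) ∂μ) := by
  have hnn := integral_rankOne_nonneg μ hΨ
  have htr : HasTrace (∫ x, InnerProductSpace.rankOne ℂ (Ψ x) (Ψ x) ∂μ) 1 := by
    have h1 := hasTrace_integral_rankOne_comp μ hΨ (ContinuousLinearMap.id ℂ _)
    have h2 : ∀ x, ⟪Ψ x, Ψ x⟫_ℂ = 1 := fun x => by
      rw [inner_self_eq_norm_sq_to_K, hnorm]
      simp
    simpa only [ContinuousLinearMap.comp_id, ContinuousLinearMap.id_apply, h2, integral_const,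
      probReal_univ, one_smul] using h1
  set ρ := ∫ x, InnerProductSpace.rankOne ℂ (Ψ x) (Ψ x) ∂μ with hρ
  have hzero : ∀ φ ψ : Fock h, (∀ x, ⟪φ, Ψ x⟫_ℂ * ⟪Ψ x, ψ⟫_ℂ = 0) → ⟪φ, ρ ψ⟫_ℂ = 0 :=
    fun φ ψ h0 => by
      rw [hρ, inner_integral_rankOne μ hΨ]
      simp [h0]
  have hmem : ∀ ψ, ρ ψ ∈ sector h N := fun ψ => by
    rw [← Submodule.orthogonal_orthogonal (sector h N), Submodule.mem_orthogonal]
    intro φ hφ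
    exact hzero φ ψ fun x => by rw [inner_eq_zero_symm.1 (hφ _ (hsec x)), zero_mul]
  refine ⟨⟨⟨1, ?_⟩, hnn, htr, fun m n hmn φ hφ ψ hψ => ?_⟩, fun ψ => ?_, fun ψ => ?_⟩
  · rwa [CFC.abs_of_nonneg ρ hnn]
  · refine hzero φ ψ fun x => ?_
    by_cases hm : m = N
    · have hn : N ≠ n := by
        rintro rfl
        rw [hm, sub_self] at hmn
        exact absurd hmn (by decide)
      rw [inner_sector_of_ne hn (hsec x) hψ, mul_zero]
    · rw [inner_sector_of_ne hm hφ (hsec x), zero_mul]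
  · have h1 : (ρ ψ, (N : ℂ) • ρ ψ) ∈ (numberOperator h).graph := by
      rw [numberOperator_graph]
      intro n
      change (sector h n).starProjection ((N : ℂ) • ρ ψ) =
        (n : ℂ) • (sector h n).starProjection (ρ ψ)
      rw [map_smul]
      by_cases hn : n = N
      · rw [hn]
      · have h2 : (sector h n).starProjection (ρ ψ) = 0 :=
          (Submodule.starProjection_apply_eq_zero_iff _).2 fun φ hφ =>
            inner_sector_of_ne hn hφ (hmem ψ)
        rw [h2, smul_zero, smul_zero]
    obtain ⟨y, hy1, hy2⟩ := (LinearPMap.mem_graph_iff _).1 h1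
    have hy : (y : Fock h) = ρ ψ := hy1
    refine ⟨hy ▸ y.2, ?_⟩
    refine Eq.trans ?_ hy2
    congr 1
    exact Subtype.ext hy.symm
  · have h1 : ((ψ : Fock h), numberOperator h ψ) ∈ numberGraph h := by
      rw [← numberOperator_graph]
      exact LinearPMap.mem_graph _ ψ
    have h2 := h1 N
    have h3 : ∀ x φ, ⟪Ψ x, (sector h N).starProjection φ⟫_ℂ = ⟪Ψ x, φ⟫_ℂ := fun x φ => by
      rw [← Submodule.inner_starProjection_left_eq_right,
        Submodule.starProjection_eq_self_iff.2 (hsec x)]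
    have h4 : ∀ x, ⟪Ψ x, numberOperator h ψ⟫_ℂ = (N : ℂ) * ⟪Ψ x, (ψ : Fock h)⟫_ℂ := fun x => by
      rw [← h3, h2, inner_smul_right, h3]
    refine ext_inner_left ℂ fun φ => ?_
    rw [inner_smul_right, hρ, inner_integral_rankOne μ hΨ, inner_integral_rankOne μ hΨ,
      ← integral_const_mul]
    simp only [h4]
    congr 1
    funext x
    ring

variable [CompleteSpace h] {J : Set ℕ} {N : ℕ} {f : J → h} (hf : Orthonormal ℂ f)
  {G : Fin N → lp (fun _ : J => ℂ) 2} (hG : Orthonormal ℂ G)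

include hf in
lemma continuous_wedge_phaseOrbital : Continuous fun θ => wedge (phaseOrbital f G θ) :=
  (continuous_wedge N).comp (continuous_pi fun n => continuous_phaseOrbital hf G n)

include hf hG in
lemma isNParticleDensityMatrix_phaseAverage :
    IsNParticleDensityMatrix N (phaseAverage f G) :=
  isNParticleDensityMatrix_integral (phaseMeasure J) (continuous_wedge_phaseOrbital hf)
    (fun θ => norm_wedge (orthonormal_phaseOrbital hf hG θ)) fun _ => wedge_mem_sector _

include hf hG in
/-- The one-particle reduced density matrix of the phase average is the average of the projections
onto the orbitals, whose cross terms between different modes vanish. -/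
lemma isOneRDM_phaseAverage {γ : h →L[ℂ] h} {lam : J → ℝ}
    (hγ : ∀ x, HasSum (fun j => ((lam j : ℂ) * ⟪f j, x⟫_ℂ) • f j) (γ x))
    (hlam : ∀ j, ∑ n, ‖G n j‖ ^ 2 = lam j) : IsOneRDM (phaseAverage f G) γ := by
  intro x y
  have h1 := hasTrace_integral_rankOne_comp (phaseMeasure J)
    (continuous_wedge_phaseOrbital (G := G) hf) (creation x ∘L annihilation y)
  have h2 : ∀ θ, ⟪wedge (phaseOrbital f G θ),
      (creation x ∘L annihilation y) (wedge (phaseOrbital f G θ))⟫_ℂ =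
      ∑ n, ⟪y, phaseOrbital f G θ n⟫_ℂ * ⟪phaseOrbital f G θ n, x⟫_ℂ := fun θ => by
    rw [← inner_annihilation_wedge (orthonormal_phaseOrbital hf hG θ),
      ContinuousLinearMap.comp_apply, annihilation.eq_1 x, ContinuousLinearMap.adjoint_inner_left]
  simp only [h2] at h1
  have h3 : ∫ θ, ∑ n, ⟪y, phaseOrbital f G θ n⟫_ℂ * ⟪phaseOrbital f G θ n, x⟫_ℂ ∂phaseMeasure J =
      ⟪y, γ x⟫_ℂ := by
    rw [integral_finsetSum _ fun n _ => integrable_of_continuous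
      (by have := continuous_phaseOrbital hf G n; fun_prop) _]
    have h4 := hasSum_sum fun n (_ : n ∈ Finset.univ) => hasSum_integral_phaseOrbital hf G n x y
    refine h4.unique ?_
    have h5 := (hγ x).mapL (innerSL ℂ y)
    simp only [innerSL_apply_apply, inner_smul_right] at h5
    have h6 : ∀ j, ∑ n, ((‖G n j‖ ^ 2 : ℝ) : ℂ) * (⟪y, f j⟫_ℂ * ⟪f j, x⟫_ℂ) =
        lam j * ⟪f j, x⟫_ℂ * ⟪y, f j⟫_ℂ := fun j => by
      rw [← Finset.sum_mul, ← hlam j]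
      push_cast
      ring
    simpa only [h6] using h5
  rw [h3] at h1
  exact h1

end State

end FermiFock

theorem theorem4p2 {h : Type*} [NormedAddCommGroup h] [InnerProductSpace ℂ h] [CompleteSpace h]
    [TopologicalSpace.SeparableSpace h] (N : ℕ) (hN : 2 ≤ N) (γ : h →L[ℂ] h)
    (hγ : FermiFock.IsOneParticleDensityMatrix γ) (htr : FermiFock.HasTrace γ (N : ℂ)) :
    FermiFock.IsNRepresentable N γ ∧
    (∃ ρ : FermiFock.Fock h →L[ℂ] FermiFock.Fock h, FermiFock.IsPhaseAveragedMixture N γ ρ) ∧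
    ∀ ρ : FermiFock.Fock h →L[ℂ] FermiFock.Fock h, FermiFock.IsPhaseAveragedMixture N γ ρ →
      FermiFock.IsNParticleDensityMatrix N ρ ∧ FermiFock.IsOneRDM ρ γ := by
  have hmix : ∀ ρ : FermiFock.Fock h →L[ℂ] FermiFock.Fock h,
      FermiFock.IsPhaseAveragedMixture N γ ρ →
        FermiFock.IsNParticleDensityMatrix N ρ ∧ FermiFock.IsOneRDM ρ γ := by
    rintro _ ⟨J, f, lam, G, hf, -, hsum, hG, hGlam, rfl⟩
    exact ⟨FermiFock.isNParticleDensityMatrix_phaseAverage hf hG,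
      FermiFock.isOneRDM_phaseAverage hf hG hsum hGlam⟩
  obtain ⟨J, f, lam, hf, hpos, hle, hlam, hsum⟩ :=
    FermiFock.exists_spectral_decomposition hγ.nonneg hγ.le_one (t := N) (by exact_mod_cast htr)
  obtain ⟨G, hG, hGlam⟩ :=
    FermiFock.exists_orthonormal_lp lam (fun j => (hpos j).le) hle hlam
  have hex : FermiFock.IsPhaseAveragedMixture N γ (FermiFock.phaseAverage f G) :=
    ⟨J, f, lam, G, hf, hpos, hsum, hG, hGlam, rfl⟩
  exact ⟨⟨_, hmix _ hex⟩, ⟨_, hex⟩, hmix⟩
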